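/- Let $M:[0,\infty)\to[0,\infty)$ be given by $M(0)=0$, $M(t)=\frac{e^2}{4}e^{-1/t}$ for $0<t<\frac12$ and $M(t)=t^2$ for $t\ge\frac12$. Then $M$ is an Orlicz function, that is, $M$ is convex, non-decreasing and continuous, $M(0)=0$ and $\lim_{t\to\infty}M(t)=\infty$. Let $\ell_M$ be the space of all real sequences $x=(a_n)_{n\in\mathbb N}$ with $\sum_n M(|a_n|/\lambda)<\infty$ for some $\lambda>0$, with the norm $$\|x\|=\inf\Big\{\lambda>0:\ \sum_n M(|a_n|/\lambda)\le 1\Big\},$$ let $e_n$ be the $n$-th unit vector and let $h_M=\overline{\operatorname{span}}\{e_n:n\in\mathbb N\}\subseteq\ell_M$. Then: 1. $\ell_M$ is a Banach space, and $h_M$ is a solid Banach lattice of bounded real functions on $\mathbb N$ with $\|e_n\|=1$ for all $n$. (Solid: if $x\in h_M$ and $y:\mathbb N\to\mathbb R$ satisfies $|y(n)|\le|x(n)|$ for all $n$, then $y\in h_M$ and $\|y\|\le\|x\|$.) 2. $(e_n)$ is a $1$-symmetric basis of $h_M$: every $x\in h_M$ has a unique unconditionally convergent expansion $x=\sum_n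 a_ne_n$; $\|\sum_{n\in F}b_ne_n\|\le\|\sum_{n\in F}a_ne_n\|$ whenever $F$ is finite and $|b_n|\le|a_n|$ for $n\in F$; and for every permutation $\pi$ of $\mathbb N$ the series $\sum_n a_{\pi(n)}e_n$ converges unconditionally in $h_M$ to a vector of norm $\|x\|$. 3. $h_M$ is strictly convex. 4. $h_M$ is M-embedded: $(h_M)^{***}=(h_M)^{*}\oplus_1(h_M)^{\perp}$, where $(h_M)^*$ is canonically embedded and $(h_M)^\perp$ is the annihilator in $(h_M)^{***}$ of the canonical image of $h_M$ in $(h_M)^{**}$. 5. $h_M$ has the local diameter two property (LD2P): for every $f\in (h_M)^*$ with $\|f\|=1$ and every $\varepsilon>0$ the slice $\{x\in h_M:\|x\|\le1,\ f(x)>1-\varepsilon\}$ has diameter $2$. 6. $h_M$ is not uniformly strictly monotone at any coordinate: there are no $n\in\mathbb N$ and $\varepsilon>0$ such that $$\sup\{\|x-x(n)e_n\|:\ x\in h_M,\ \|x\|=1,\ x(n)>1-\varepsilon\}<1.$$ 7. $\mathfrak L_{\mathfrak F}:=\sup\{\|\mathbf 1_A\|:A\subset\mathbb N\text{ finite}\}=\infty$,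 where $\mathbf 1_A=\sum_{n\in A}e_n$. -/

import Mathlib

open scoped ENNReal

set_option maxSynthPendingDepth 3

/-! ### Orlicz functions and Orlicz sequence spaces (Luxemburg norm, real scalars) -/

/-- An Orlicz function: a convex, non-decreasing, continuous function `M` on `[0, ∞)` with
`M 0 = 0` and `M t → ∞` as `t → ∞`. Only the values on `[0, ∞)` are ever used. -/
structure OrliczFunction where
  toFun : ℝ → ℝ
  convexOn : ConvexOn ℝ (Set.Ici 0) toFun
  monotoneOn : MonotoneOn toFun (Set.Ici 0)
  continuousOn : ContinuousOn toFun (Set.Ici 0)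
  map_zero : toFun 0 = 0
  tendsto_atTop : Filter.Tendsto toFun Filter.atTop Filter.atTop

namespace OrliczFunction

variable (M : OrliczFunction)

theorem nonneg {t : ℝ} (ht : 0 ≤ t) : 0 ≤ M.toFun t := by
  have h := M.monotoneOn (Set.mem_Ici.2 le_rfl) (Set.mem_Ici.2 ht) ht
  rwa [M.map_zero] at h

/-- The modular `Φ(x) = ∑ₙ M(|xₙ|)`, with values in `[0, ∞]`. -/
noncomputable def modular (x : ℕ → ℝ) : ℝ≥0∞ :=
  ∑' n, ENNReal.ofReal (M.toFun |x n|)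

theorem modular_mono {x y : ℕ → ℝ} (h : ∀ n, |x n| ≤ |y n|) : M.modular x ≤ M.modular y :=
  ENNReal.tsum_le_tsum fun n => ENNReal.ofReal_le_ofReal
    (M.monotoneOn (Set.mem_Ici.2 (abs_nonneg _)) (Set.mem_Ici.2 (abs_nonneg _)) (h n))

theorem modular_zero : M.modular 0 = 0 := by
  simp [modular, M.map_zero]

/-- Convexity of the modular. -/
theorem modular_combo (x y : ℕ → ℝ) {s t : ℝ} (hs : 0 ≤ s) (ht : 0 ≤ t) (hst : s + t = 1) :
    M.modular (s • x + t • y) ≤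
      ENNReal.ofReal s * M.modular x + ENNReal.ofReal t * M.modular y := by
  unfold modular
  rw [← ENNReal.tsum_mul_left, ← ENNReal.tsum_mul_left, ← ENNReal.tsum_add]
  refine ENNReal.tsum_le_tsum fun n => ?_
  rw [← ENNReal.ofReal_mul hs, ← ENNReal.ofReal_mul ht, ← ENNReal.ofReal_add
    (mul_nonneg hs (M.nonneg (abs_nonneg _))) (mul_nonneg ht (M.nonneg (abs_nonneg _)))]
  refine ENNReal.ofReal_le_ofReal ?_
  have h1 : |(s • x + t • y) n| ≤ s * |x n| + t * |y n| := by
    simp only [Pi.add_apply, Pi.smul_apply, smul_eq_mul]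
    refine (abs_add_le _ _).trans ?_
    rw [abs_mul, abs_mul, abs_of_nonneg hs, abs_of_nonneg ht]
  have h2 : 0 ≤ s * |x n| + t * |y n| := (abs_nonneg _).trans h1
  refine (M.monotoneOn (Set.mem_Ici.2 (abs_nonneg _)) (Set.mem_Ici.2 h2) h1).trans ?_
  simpa using M.convexOn.2 (Set.mem_Ici.2 (abs_nonneg (x n))) (Set.mem_Ici.2 (abs_nonneg (y n)))
    hs ht hst

theorem modular_smul_le (x : ℕ → ℝ) {s : ℝ} (hs : 0 ≤ s) (hs1 : s ≤ 1) :
    M.modular (s • x) ≤ ENNReal.ofReal s * M.modular x := by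
  have h := M.modular_combo x 0 hs (sub_nonneg.2 hs1) (by ring)
  simpa [M.modular_zero] using h

theorem modular_add_div_le {x y : ℕ → ℝ} {a b : ℝ} (ha : 0 < a) (hb : 0 < b) :
    M.modular ((a + b)⁻¹ • (x + y)) ≤
      ENNReal.ofReal (a / (a + b)) * M.modular (a⁻¹ • x) +
        ENNReal.ofReal (b / (a + b)) * M.modular (b⁻¹ • y) := by
  have hab : 0 < a + b := add_pos ha hb
  have h := M.modular_combo (a⁻¹ • x) (b⁻¹ • y) (s := a / (a + b)) (t := b / (a + b))
    (by positivity) (by positivity) (by field_simp)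
  convert h using 2
  rw [smul_add, smul_smul, smul_smul]
  congr 2 <;> field_simp

/-- The set underlying `ℓ_M`: all real sequences `x` with `Φ(x / r) < ∞` for some `r > 0`. -/
def carrier : Submodule ℝ (ℕ → ℝ) where
  carrier := {x | ∃ r : ℝ, 0 < r ∧ M.modular (r⁻¹ • x) < ∞}
  zero_mem' := ⟨1, one_pos, by simp [M.modular_zero]⟩
  add_mem' := by
    rintro x y ⟨a, ha, hx⟩ ⟨b, hb, hy⟩
    exact ⟨a + b, add_pos ha hb, (M.modular_add_div_le ha hb).trans_lt
      (ENNReal.add_lt_top.2 ⟨ENNReal.mul_lt_top ENNReal.ofReal_lt_top hx,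
        ENNReal.mul_lt_top ENNReal.ofReal_lt_top hy⟩)⟩
  smul_mem' := by
    rintro c x ⟨a, ha, hx⟩
    refine ⟨(|c| + 1) * a, by positivity, (M.modular_mono fun n => ?_).trans_lt hx⟩
    have hc : 0 < |c| + 1 := by positivity
    simp only [Pi.smul_apply, smul_eq_mul, abs_mul, abs_inv, abs_of_pos ha, abs_of_pos hc]
    rw [mul_inv, mul_comm (|c| + 1)⁻¹, mul_assoc]
    refine mul_le_mul_of_nonneg_left ?_ (by positivity)
    rw [← mul_assoc, inv_mul_eq_div]
    exact mul_le_of_le_one_left (abs_nonneg _) ((div_le_one hc).2 (by linarith))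

end OrliczFunction

/-- The Orlicz sequence space `ℓ_M` (a type synonym, so that it carries the Luxemburg norm and not
the product topology). -/
def OrliczSpace (M : OrliczFunction) : Type := M.carrier

namespace OrliczSpace

variable {M : OrliczFunction}

noncomputable instance : AddCommGroup (OrliczSpace M) := inferInstanceAs (AddCommGroup M.carrier)

noncomputable instance : Module ℝ (OrliczSpace M) := inferInstanceAs (Module ℝ M.carrier)

/-- The sequence underlying an element of `ℓ_M`. -/
def coord : OrliczSpace M →ₗ[ℝ] (ℕ → ℝ) := M.carrier.subtype

/-- The set of `r > 0` with `∑ₙ M(|xₙ| / r) ≤ 1`. -/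
def gaugeSet (x : OrliczSpace M) : Set ℝ := {r | 0 < r ∧ M.modular (r⁻¹ • coord x) ≤ 1}

/-- The Luxemburg norm `‖x‖ = inf {r > 0 : ∑ₙ M(|xₙ| / r) ≤ 1}`. -/
noncomputable instance : Norm (OrliczSpace M) := ⟨fun x => sInf (gaugeSet x)⟩

theorem norm_def (x : OrliczSpace M) : ‖x‖ = sInf (gaugeSet x) := rfl

theorem gaugeSet_nonempty (x : OrliczSpace M) : (gaugeSet x).Nonempty := by
  obtain ⟨a, ha, hx⟩ := x.2
  set K : ℝ := (M.modular (a⁻¹ • coord x)).toReal + 1 with hK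
  have hK1 : 1 ≤ K := by simp [hK]
  have hK0 : 0 < K := by linarith
  refine ⟨K * a, by positivity, ?_⟩
  have h := M.modular_smul_le (a⁻¹ • coord x) (s := K⁻¹) (by positivity) (inv_le_one_of_one_le₀ hK1)
  rw [smul_smul, ← mul_inv] at h
  refine h.trans ?_
  rw [← ENNReal.ofReal_toReal (show M.modular (a⁻¹ • coord x) ≠ ∞ from hx.ne), ← ENNReal.ofReal_mul (by positivity)]
  refine ENNReal.ofReal_le_one.2 ?_
  rw [inv_mul_le_iff₀ hK0]
  change (M.modular (a⁻¹ • coord x)).toReal ≤ K * 1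
  linarith

theorem gaugeSet_bddBelow (x : OrliczSpace M) : BddBelow (gaugeSet x) :=
  ⟨0, fun _ hr => hr.1.le⟩

theorem norm_smul_aux (c : ℝ) (x : OrliczSpace M) : ‖c • x‖ ≤ |c| * ‖x‖ := by
  rcases eq_or_ne c 0 with rfl | hc
  · have h0 : ‖(0 : ℝ) • x‖ ≤ 0 := by
      refine le_of_forall_pos_le_add fun ε hε => ?_
      rw [zero_add]
      refine csInf_le (gaugeSet_bddBelow _) ⟨hε, ?_⟩
      simp [M.modular_zero]
    simpa using h0
  · have hc' : 0 < |c| := abs_pos.2 hc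
    rw [← div_le_iff₀' hc']
    refine le_csInf (gaugeSet_nonempty x) fun r hr => ?_
    rw [div_le_iff₀' hc']
    refine csInf_le (gaugeSet_bddBelow _) ⟨mul_pos hc' hr.1, le_trans (M.modular_mono fun n => ?_) hr.2⟩
    simp only [map_smul, Pi.smul_apply, smul_eq_mul, abs_mul, abs_inv, abs_abs]
    rw [mul_inv]
    apply le_of_eq
    field_simp

theorem core : NormedSpace.Core ℝ (OrliczSpace M) where
  norm_nonneg x := Real.sInf_nonneg fun _ hr => hr.1.le
  norm_smul c x := by
    rw [Real.norm_eq_abs]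
    refine le_antisymm (norm_smul_aux c x) ?_
    rcases eq_or_ne c 0 with rfl | hc
    · rw [abs_zero, zero_mul, norm_def]
      exact Real.sInf_nonneg fun _ hr => hr.1.le
    · have h := norm_smul_aux c⁻¹ (c • x)
      rw [smul_smul, inv_mul_cancel₀ hc, one_smul, abs_inv] at h
      have hc' : 0 < |c| := abs_pos.2 hc
      rwa [← le_inv_mul_iff₀ hc']
  norm_triangle x y := by
    have key : ∀ a ∈ gaugeSet x, ∀ b ∈ gaugeSet y, ‖x + y‖ ≤ a + b := by
      intro a ha b hb
      have ha0 := ha.1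
      have hb0 := hb.1
      refine csInf_le (gaugeSet_bddBelow _) ⟨add_pos ha.1 hb.1, ?_⟩
      rw [map_add]
      refine (M.modular_add_div_le ha.1 hb.1).trans ?_
      refine (add_le_add (mul_le_mul_right ha.2 _) (mul_le_mul_right hb.2 _)).trans ?_
      rw [mul_one, mul_one, ← ENNReal.ofReal_add (by positivity) (by positivity), ← add_div,
        div_self (add_pos ha0 hb0).ne', ENNReal.ofReal_one]
    have h1 : ∀ a ∈ gaugeSet x, ‖x + y‖ - a ≤ ‖y‖ := fun a ha =>
      le_csInf (gaugeSet_nonempty y) fun b hb => by linarith [key a ha b hb]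
    have h2 : ‖x + y‖ - ‖y‖ ≤ ‖x‖ :=
      le_csInf (gaugeSet_nonempty x) fun a ha => by linarith [h1 a ha]
    linarith
  norm_eq_zero_iff x := by
    constructor
    · intro hx
      have hsmall : ∀ ε : ℝ, 0 < ε → ∀ n, M.toFun (ε⁻¹ * |coord x n|) ≤ 1 := by
        intro ε hε n
        obtain ⟨r, hr, hrε⟩ := exists_lt_of_csInf_lt (gaugeSet_nonempty x)
          (show sInf (gaugeSet x) < ε by rw [← norm_def, hx]; exact hε)
        have h1 : ENNReal.ofReal (M.toFun |(r⁻¹ • coord x) n|) ≤ 1 :=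
          (ENNReal.le_tsum n).trans hr.2
        rw [ENNReal.ofReal_le_one] at h1
        simp only [Pi.smul_apply, smul_eq_mul, abs_mul, abs_inv, abs_of_pos hr.1] at h1
        refine (M.monotoneOn ?_ ?_ ?_).trans h1
        · exact Set.mem_Ici.2 (by positivity)
        · exact Set.mem_Ici.2 (mul_nonneg (inv_nonneg.2 hr.1.le) (abs_nonneg _))
        · exact mul_le_mul_of_nonneg_right (inv_anti₀ hr.1 hrε.le) (abs_nonneg _)
      refine Subtype.ext (funext fun n => ?_)
      change coord x n = 0
      by_contra hn
      have hn' : 0 < |coord x n| := abs_pos.2 hn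
      obtain ⟨T, hT1, hT0⟩ := ((M.tendsto_atTop.eventually_gt_atTop 1).and
        (Filter.eventually_gt_atTop 0)).exists
      have h := hsmall (|coord x n| / T) (by positivity) n
      rw [inv_div, div_mul_cancel₀ _ hn'.ne'] at h
      linarith
    · rintro rfl
      refine le_antisymm ?_ (Real.sInf_nonneg fun _ hr => hr.1.le)
      simpa using norm_smul_aux (0 : ℝ) (0 : OrliczSpace M)

noncomputable instance : NormedAddCommGroup (OrliczSpace M) := NormedAddCommGroup.ofCore core

noncomputable instance : NormedSpace ℝ (OrliczSpace M) := NormedSpace.ofCore core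

variable (M)

/-- The `n`-th unit vector of `ℓ_M`. -/
noncomputable def unitVec (n : ℕ) : OrliczSpace M :=
  ⟨Pi.single n 1, 1, one_pos, by
    unfold OrliczFunction.modular
    rw [tsum_eq_single n]
    · exact ENNReal.ofReal_lt_top
    · intro m hm
      simp [hm, M.map_zero]⟩

/-- `h_M`, the closed linear span of the unit vectors in `ℓ_M`. -/
noncomputable def hSpace : Submodule ℝ (OrliczSpace M) :=
  (Submodule.span ℝ (Set.range (unitVec M))).topologicalClosure

/-- The `n`-th unit vector, as an element of `h_M`. -/
noncomputable def hUnitVec (n : ℕ) : hSpace M :=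
  ⟨unitVec M n, Submodule.le_topologicalClosure _ (Submodule.subset_span ⟨n, rfl⟩)⟩

/-- The sequence underlying an element of `h_M`. -/
noncomputable def hCoord : hSpace M →ₗ[ℝ] (ℕ → ℝ) := coord ∘ₗ (hSpace M).subtype

end OrliczSpace

/-! ### Banach space notions -/

section BanachNotions

variable {Γ X : Type*} [NormedAddCommGroup X] [NormedSpace ℝ X]

/-- `X`, realised by `ι` as a space of bounded real functions on `Γ`, is a solid Banach lattice of
real functions, with unit vectors of norm one. -/
structure IsSolidBanachLattice [DecidableEq Γ] (ι : X →ₗ[ℝ] (Γ → ℝ)) : Prop where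
  complete : CompleteSpace X
  injective : Function.Injective ι
  bounded : ∀ x, ∃ C : ℝ, ∀ γ, |ι x γ| ≤ C
  solid : ∀ (x : X) (y : Γ → ℝ), (∀ γ, |y γ| ≤ |ι x γ|) → ∃ z, ι z = y ∧ ‖z‖ ≤ ‖x‖
  unit : ∀ γ, ∃ z, ι z = Pi.single γ 1 ∧ ‖z‖ = 1

/-- `e` is an unconditional basis: every `x` has a unique unconditionally convergent expansion
`x = ∑ a_γ e_γ`. -/
def IsUnconditionalBasis (e : Γ → X) : Prop :=
  ∀ x : X, ∃! a : Γ → ℝ, HasSum (fun γ => a γ • e γ) x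

/-- `e` is a `1`-unconditional basis. -/
def IsOneUnconditionalBasis (e : Γ → X) : Prop :=
  IsUnconditionalBasis e ∧
    ∀ (F : Finset Γ) (a b : Γ → ℝ), (∀ γ ∈ F, |b γ| ≤ |a γ|) →
      ‖∑ γ ∈ F, b γ • e γ‖ ≤ ‖∑ γ ∈ F, a γ • e γ‖

/-- `e` is a `1`-symmetric basis: it is `1`-unconditional and permuting the coefficients of a
vector gives a vector of the same norm. -/
def IsOneSymmetricBasis (e : Γ → X) : Prop :=
  IsOneUnconditionalBasis e ∧
    ∀ (x : X) (a : Γ → ℝ) (π : Equiv.Perm Γ), HasSum (fun γ => a γ • e γ) x →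
      ∃ y : X, HasSum (fun γ => a (π γ) • e γ) y ∧ ‖y‖ = ‖x‖

/-- `E_α(ε) = sup {‖x - x(α) e_α‖ : ‖x‖ = 1, x(α) > 1 - ε}`, a supremum in `[0, ∞]`. -/
noncomputable def strictMonotonicityModulus (ι : X →ₗ[ℝ] (Γ → ℝ)) (e : Γ → X) (α : Γ) (ε : ℝ) :
    ℝ≥0∞ :=
  ⨆ (x : X) (_ : ‖x‖ = 1) (_ : 1 - ε < ι x α), ‖x - ι x α • e α‖ₑ

/-- `X` is uniformly strictly monotone at `α`: `E_α(ε) < 1` for some `ε > 0`. -/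
def IsUniformlyStrictlyMonotoneAt (ι : X →ₗ[ℝ] (Γ → ℝ)) (e : Γ → X) (α : Γ) : Prop :=
  ∃ ε : ℝ, 0 < ε ∧ strictMonotonicityModulus ι e α ε < 1

/-- `𝔏_F`, the supremum in `[0, ∞]` of the norms of the indicator functions
`1_A = ∑_{γ ∈ A} e_γ` of finite sets `A`. -/
noncomputable def finiteIndicatorSup (e : Γ → X) : ℝ≥0∞ :=
  ⨆ A : Finset Γ, ‖∑ γ ∈ A, e γ‖ₑ

variable (X)

/-- The local diameter two property: every slice of the unit ball has diameter two. -/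
def LocalDiameterTwoProperty : Prop :=
  ∀ (f : StrongDual ℝ X) (ε : ℝ), ‖f‖ = 1 → 0 < ε →
    Metric.diam {x : X | ‖x‖ ≤ 1 ∧ 1 - ε < f x} = 2

/-- The canonical copy of `X*` in `X***`. -/
noncomputable def dualInTripleDual :
    Submodule ℝ (StrongDual ℝ (StrongDual ℝ (StrongDual ℝ X))) :=
  LinearMap.range (NormedSpace.inclusionInDoubleDual ℝ (StrongDual ℝ X)).toLinearMap

/-- The annihilator `X^⊥` in `X***` of the canonical copy of `X` in `X**`. -/
noncomputable def annihilatorInTripleDual :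
    Submodule ℝ (StrongDual ℝ (StrongDual ℝ (StrongDual ℝ X))) where
  carrier := {φ | ∀ x : X, φ (NormedSpace.inclusionInDoubleDual ℝ X x) = 0}
  zero_mem' := fun _ => rfl
  add_mem' := fun {φ ψ} hφ hψ x => by
    rw [_root_.add_apply, hφ x, hψ x, add_zero]
  smul_mem' := fun c φ hφ x => by
    rw [_root_.smul_apply, hφ x, smul_zero]

/-- `X` is M-embedded: `X*** = X* ⊕₁ X^⊥`, i.e. `X` is an M-ideal in its bidual. -/
def IsMEmbedded : Prop :=
  IsCompl (dualInTripleDual X) (annihilatorInTripleDual X) ∧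
    ∀ f ∈ dualInTripleDual X, ∀ g ∈ annihilatorInTripleDual X, ‖f + g‖ = ‖f‖ + ‖g‖

end BanachNotions

/-! ### The explicit Orlicz function -/

/-- `M(0) = 0`, `M(t) = (e²/4) e^{-1/t}` on `(0, 1/2)` and `M(t) = t²` for `t ≥ 1/2` (and, as an
irrelevant convention, `M(t) = 0` for `t < 0`). -/
noncomputable def expOrliczFun (t : ℝ) : ℝ :=
  if t ≤ 0 then 0
  else if t < 1 / 2 then 1 / 4 * Real.exp 1 ^ 2 * Real.exp (-1 / t)
  else t ^ 2

/-- The derivative of `expOrliczFun` on `(0, ∞)`. -/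
noncomputable def expOrliczDeriv (t : ℝ) : ℝ :=
  if t < 1 / 2 then 1 / 4 * Real.exp 1 ^ 2 * Real.exp (-1 / t) / t ^ 2 else 2 * t

theorem expOrliczFun_eq_glue {t : ℝ} (ht : t ≤ 1 / 2) :
    expOrliczFun t = 1 / 4 * Real.exp 1 ^ 2 * expNegInvGlue t := by
  unfold expOrliczFun expNegInvGlue
  rcases le_or_gt t 0 with h | h
  · simp [h]
  · rw [if_neg h.not_ge, if_neg h.not_ge]
    rcases ht.lt_or_eq with h' | rfl
    · rw [if_pos h', neg_div, one_div t]
    · rw [if_neg (lt_irrefl _), ← Real.exp_nat_mul, mul_assoc, ← Real.exp_add]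
      norm_num

theorem expOrliczFun_eq_sq {t : ℝ} (ht : 1 / 2 ≤ t) : expOrliczFun t = t ^ 2 := by
  unfold expOrliczFun
  rw [if_neg (by linarith : ¬ t ≤ 0), if_neg ht.not_gt]

theorem expOrliczFun_hasDerivAt {t : ℝ} (ht : 0 < t) :
    HasDerivAt expOrliczFun (expOrliczDeriv t) t := by
  have hexp : HasDerivAt (fun s : ℝ => 1 / 4 * Real.exp 1 ^ 2 * expNegInvGlue s)
      (1 / 4 * Real.exp 1 ^ 2 * Real.exp (-1 / t) / t ^ 2) t := by
    have h1 : HasDerivAt (fun s : ℝ => 1 / 4 * Real.exp 1 ^ 2 * Real.exp (-s⁻¹))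
        (1 / 4 * Real.exp 1 ^ 2 * Real.exp (-1 / t) / t ^ 2) t := by
      have := (((hasDerivAt_inv ht.ne').neg).exp).const_mul (1 / 4 * Real.exp 1 ^ 2)
      refine this.congr_deriv ?_
      rw [neg_div, one_div t, neg_neg, Pi.neg_apply]
      ring
    refine h1.congr_of_eventuallyEq ?_
    filter_upwards [lt_mem_nhds ht] with s hs
    rw [expNegInvGlue, if_neg hs.not_ge]
  have hsq : HasDerivAt (fun s : ℝ => s ^ 2) (2 * t) t := by
    simpa using hasDerivAt_pow 2 t
  rcases lt_trichotomy t (1 / 2) with h | h | h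
  · rw [expOrliczDeriv, if_pos h]
    refine hexp.congr_of_eventuallyEq ?_
    filter_upwards [gt_mem_nhds h] with s hs using expOrliczFun_eq_glue hs.le
  · subst h
    have hval : 1 / 4 * Real.exp 1 ^ 2 * Real.exp (-1 / (1 / 2)) / (1 / 2 : ℝ) ^ 2
        = 2 * (1 / 2) := by
      rw [← Real.exp_nat_mul, mul_assoc, ← Real.exp_add]
      norm_num
    rw [hval] at hexp
    rw [expOrliczDeriv, if_neg (lt_irrefl _), ← hasDerivWithinAt_univ, ← Set.Iic_union_Ici]
    exact (hexp.hasDerivWithinAt.congr (fun s hs => expOrliczFun_eq_glue hs)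
      (expOrliczFun_eq_glue le_rfl)).union
      (hsq.hasDerivWithinAt.congr (fun s hs => expOrliczFun_eq_sq hs) (expOrliczFun_eq_sq le_rfl))
  · rw [expOrliczDeriv, if_neg h.not_gt]
    refine hsq.congr_of_eventuallyEq ?_
    filter_upwards [lt_mem_nhds h] with s hs using expOrliczFun_eq_sq hs.le

theorem expOrliczFun_continuous : Continuous expOrliczFun := by
  have h : expOrliczFun = fun t =>
      if t ≤ 1 / 2 then 1 / 4 * Real.exp 1 ^ 2 * expNegInvGlue t else t ^ 2 := by
    funext t
    split_ifs with h
    · exact expOrliczFun_eq_glue h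
    · exact expOrliczFun_eq_sq (not_le.1 h).le
  rw [h]
  refine Continuous.if_le ?_ (by fun_prop) continuous_id continuous_const ?_
  · exact continuous_const.mul (expNegInvGlue.contDiff (n := 0)).continuous
  · rintro t rfl
    rw [← expOrliczFun_eq_glue le_rfl, expOrliczFun_eq_sq le_rfl]

theorem expOrliczDeriv_nonneg {t : ℝ} (ht : 0 < t) : 0 ≤ expOrliczDeriv t := by
  unfold expOrliczDeriv
  split_ifs <;> positivity

theorem expOrliczDeriv_monotoneOn : MonotoneOn expOrliczDeriv (Set.Ioi 0) := by
  have hL : ∀ s t : ℝ, 0 < s → s ≤ t → t ≤ 1 / 2 →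
      Real.exp (-1 / s) / s ^ 2 ≤ Real.exp (-1 / t) / t ^ 2 := by
    intro s t hs hst ht
    have ht0 : 0 < t := hs.trans_le hst
    have h1 : t / s ≤ Real.exp ((1 / s - 1 / t) / 2) := by
      have h2 : t / s ≤ (1 / s - 1 / t) / 2 + 1 := by
        have h3 : (1 / s - 1 / t) / 2 + 1 - t / s = (t - s) * (1 / 2 - t) / (s * t) := by
          field_simp
          ring
        have h4 : 0 ≤ (t - s) * (1 / 2 - t) / (s * t) :=
          div_nonneg (mul_nonneg (by linarith) (by linarith)) (by positivity)
        linarith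
      exact h2.trans (Real.add_one_le_exp _)
    have h5 : (t / s) ^ 2 ≤ Real.exp (1 / s - 1 / t) := by
      refine (pow_le_pow_left₀ (by positivity) h1 2).trans_eq ?_
      rw [← Real.exp_nat_mul]
      congr 1
      push_cast
      ring
    rw [div_le_div_iff₀ (by positivity) (by positivity)]
    have h6 : Real.exp (-1 / t) = Real.exp (-1 / s) * Real.exp (1 / s - 1 / t) := by
      rw [← Real.exp_add]
      congr 1
      ring
    rw [h6, mul_assoc]
    refine mul_le_mul_of_nonneg_left ?_ (Real.exp_pos _).le
    rwa [div_pow, div_le_iff₀ (by positivity)] at h5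
  have hhalf : 1 / 4 * Real.exp 1 ^ 2 * (Real.exp (-1 / (1 / 2)) / (1 / 2 : ℝ) ^ 2) = 1 := by
    rw [← mul_div_assoc, ← Real.exp_nat_mul, mul_assoc, ← Real.exp_add]
    norm_num
  intro s hs t ht hst
  rw [Set.mem_Ioi] at hs ht
  unfold expOrliczDeriv
  split_ifs with h1 h2 h2
  · rw [mul_div_assoc, mul_div_assoc]
    exact mul_le_mul_of_nonneg_left (hL s t hs hst h2.le) (by positivity)
  · rw [mul_div_assoc]
    have h3 := mul_le_mul_of_nonneg_left (hL s (1 / 2) hs h1.le le_rfl)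
      (by positivity : 0 ≤ 1 / 4 * Real.exp 1 ^ 2)
    rw [hhalf] at h3
    linarith
  · linarith
  · linarith

/-- `expOrliczFun` as an Orlicz function. -/
noncomputable def expOrlicz : OrliczFunction where
  toFun := expOrliczFun
  convexOn := by
    have hd : ∀ t ∈ interior (Set.Ici (0 : ℝ)), HasDerivAt expOrliczFun (expOrliczDeriv t) t := by
      intro t ht
      rw [interior_Ici] at ht
      exact expOrliczFun_hasDerivAt ht
    refine MonotoneOn.convexOn_of_deriv (convex_Ici 0) expOrliczFun_continuous.continuousOn
      (fun t ht => (hd t ht).differentiableAt.differentiableWithinAt) ?_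
    intro s hs t ht hst
    rw [(hd s hs).deriv, (hd t ht).deriv]
    rw [interior_Ici] at hs ht
    exact expOrliczDeriv_monotoneOn hs ht hst
  monotoneOn := by
    refine monotoneOn_of_deriv_nonneg (convex_Ici 0) expOrliczFun_continuous.continuousOn ?_ ?_
    · intro t ht
      rw [interior_Ici] at ht
      exact (expOrliczFun_hasDerivAt ht).differentiableAt.differentiableWithinAt
    · intro t ht
      rw [interior_Ici] at ht
      rw [(expOrliczFun_hasDerivAt ht).deriv]
      exact expOrliczDeriv_nonneg ht
  continuousOn := expOrliczFun_continuous.continuousOn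
  map_zero := by simp [expOrliczFun]
  tendsto_atTop := by
    refine (Filter.tendsto_pow_atTop (two_ne_zero)).congr' ?_
    filter_upwards [Filter.eventually_ge_atTop (1 / 2 : ℝ)] with t ht
    exact (expOrliczFun_eq_sq ht).symm

/-! Everything is read off the modular `Φ(x) = ∑ M(|xₙ|)`. It is convex, additive on disjointly
supported vectors and lower semicontinuous under coordinatewise limits; hence the infimum in the
norm is attained (`norm_le_iff`), `ℓ_M` is complete, and `h_M` is exactly the set of `x` with `Φ(Kx)
< ∞` for all `K` (`mem_hSpace_iff`). This description makes solidity and symmetry evident. It also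
gives `Φ(x) = 1` on the unit sphere of `h_M`, so strict convexity of `t ↦ M(|t|)` passes to the
norm.

Two opposite features of `M` carry the rest.

Since `M(t)/t²` is non-decreasing, disjoint vectors satisfy an upper 2-estimate. Dually, the
restrictions of a functional `f` to a finite set of coordinates and to its complement satisfy a
lower 2-estimate, so `f` is the norm limit of its finite restrictions (`tendsto_comp_hProj`). The
unit ball of the bidual is then `{Φ ≤ 1}` in coordinates. For M-embeddedness, glue a finite head of
an `x` in `h_M` almost norming `f` to the far tail of a bidual element almost norming `g ∈ h_M^⊥`:
the modulars add up to at most 1, `g` does not see the change of head, and `f` does not see the tail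
in the limit (`norm_add_ge_of_annihilator`).

Since `M(ct)/M(t) → ∞` as `t → 0` for every `c > 1`, there are flat vectors with arbitrarily small
modular and norm almost 1 (`FailsDeltaTwoAtZero.exists_flat`). Adding one, with either sign, on
fresh coordinates keeps a vector of modular below 1 in the unit ball. This yields slices of diameter
2 and defeats uniform strict monotonicity. -/

namespace OrliczFunction

/-! ### Disjoint additivity and semicontinuity of the modular. -/

variable (M : OrliczFunction)

theorem modular_add_of_disjoint {x y : ℕ → ℝ} (h : ∀ n, x n = 0 ∨ y n = 0) :
    M.modular (x + y) = M.modular x + M.modular y := by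
  unfold modular
  rw [← ENNReal.tsum_add]
  refine tsum_congr fun n => ?_
  rcases h n with h | h <;> simp [h, M.map_zero]

/-- Reduces the bound to finite sums of continuous real terms, through which coordinatewise limits
pass. -/
theorem modular_le_one_iff (x : ℕ → ℝ) :
    M.modular x ≤ 1 ↔ ∀ s : Finset ℕ, ∑ n ∈ s, M.toFun |x n| ≤ 1 := by
  constructor
  · intro h s
    rw [← ENNReal.ofReal_le_one, ENNReal.ofReal_sum_of_nonneg fun n _ => M.nonneg (abs_nonneg _)]
    exact (ENNReal.sum_le_tsum s).trans h
  · intro h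
    unfold modular
    rw [ENNReal.tsum_eq_iSup_sum]
    refine iSup_le fun s => ?_
    rw [← ENNReal.ofReal_sum_of_nonneg fun n _ => M.nonneg (abs_nonneg _)]
    exact ENNReal.ofReal_le_one.2 (h s)

theorem continuous_toFun_abs : Continuous fun t : ℝ => M.toFun |t| :=
  M.continuousOn.comp_continuous continuous_abs fun t => abs_nonneg t

/-- Lower semicontinuity of the modular under coordinatewise convergence. -/
theorem modular_le_one_of_tendsto {ι : Type*} {l : Filter ι} [l.NeBot] {u : ι → ℕ → ℝ}
    {x : ℕ → ℝ} (hu : ∀ n, Filter.Tendsto (fun i => u i n) l (nhds (x n)))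
    (h : ∀ᶠ i in l, M.modular (u i) ≤ 1) : M.modular x ≤ 1 := by
  refine (M.modular_le_one_iff x).2 fun s => ?_
  refine le_of_tendsto (tendsto_finsetSum s fun n _ =>
    (M.continuous_toFun_abs.tendsto (x n)).comp (hu n)) ?_
  filter_upwards [h] with i hi using (M.modular_le_one_iff _).1 hi s

theorem modular_smul_mono (x : ℕ → ℝ) {s t : ℝ} (h : |s| ≤ |t|) :
    M.modular (s • x) ≤ M.modular (t • x) :=
  M.modular_mono fun n => by
    simp only [Pi.smul_apply, smul_eq_mul, abs_mul]
    exact mul_le_mul_of_nonneg_right h (abs_nonneg _)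

theorem modular_finsupp_lt_top {x : ℕ → ℝ} (s : Finset ℕ) (h : ∀ n ∉ s, x n = 0) :
    M.modular x < ∞ := by
  unfold modular
  rw [tsum_eq_sum (s := s) fun n hn => by simp [h n hn, M.map_zero]]
  exact ENNReal.sum_lt_top.2 fun _ _ => ENNReal.ofReal_lt_top

theorem modular_indicator_const (A : Finset ℕ) (t : ℝ) :
    M.modular (fun n => if n ∈ A then t else 0) = ENNReal.ofReal (A.card * M.toFun |t|) := by
  unfold modular
  rw [tsum_eq_sum (s := A) fun n hn => by simp [hn, M.map_zero],
    Finset.sum_congr rfl fun n hn => congrArg (fun u => ENNReal.ofReal (M.toFun |u|)) (if_pos hn),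
    Finset.sum_const, ENNReal.ofReal_mul (by positivity), nsmul_eq_mul, ENNReal.ofReal_natCast]

end OrliczFunction

/-! ### The Luxemburg norm and completeness of `ℓ_M`. -/

namespace OrliczSpace

variable {M : OrliczFunction}

theorem coord_injective : Function.Injective (coord : OrliczSpace M →ₗ[ℝ] (ℕ → ℝ)) :=
  Subtype.val_injective

theorem exists_coord_eq {x : ℕ → ℝ} {r : ℝ} (hr : 0 < r) (h : M.modular (r⁻¹ • x) < ∞) :
    ∃ z : OrliczSpace M, coord z = x := ⟨⟨x, r, hr, h⟩, rfl⟩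

/-- The infimum is attained: `Φ(x/s) ≤ 1` for all `s > r`, and semicontinuity allows `s ↓ r`. -/
theorem norm_le_iff (x : OrliczSpace M) {r : ℝ} (hr : 0 < r) :
    ‖x‖ ≤ r ↔ M.modular (r⁻¹ • coord x) ≤ 1 := by
  refine ⟨fun h => ?_, fun h => csInf_le (gaugeSet_bddBelow x) ⟨hr, h⟩⟩
  have hlim : ∀ n, Filter.Tendsto (fun s : ℝ => (s⁻¹ • coord x) n) (nhdsWithin r (Set.Ioi r))
      (nhds ((r⁻¹ • coord x) n)) := by
    intro n
    simp only [Pi.smul_apply, smul_eq_mul]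
    exact ((tendsto_inv₀ hr.ne').mul_const _).mono_left nhdsWithin_le_nhds
  refine M.modular_le_one_of_tendsto hlim ?_
  filter_upwards [self_mem_nhdsWithin] with s hs
  obtain ⟨a, ha, has⟩ := exists_lt_of_csInf_lt (gaugeSet_nonempty x) (h.trans_lt hs)
  refine (M.modular_smul_mono _ ?_).trans ha.2
  rw [abs_inv, abs_inv, abs_of_pos ha.1, abs_of_pos (ha.1.trans has)]
  exact inv_anti₀ ha.1 has.le

theorem norm_le_one_iff (x : OrliczSpace M) : ‖x‖ ≤ 1 ↔ M.modular (coord x) ≤ 1 := by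
  rw [norm_le_iff x one_pos, inv_one, one_smul]

theorem norm_le_norm_of_modular_le {x y : OrliczSpace M}
    (h : ∀ r : ℝ, M.modular (r • coord x) ≤ M.modular (r • coord y)) : ‖x‖ ≤ ‖y‖ := by
  refine le_of_forall_pos_le_add fun ε hε => ?_
  have hr : 0 < ‖y‖ + ε := by positivity
  rw [norm_le_iff x hr]
  exact (h _).trans ((norm_le_iff y hr).1 (by linarith))

theorem norm_le_norm_of_abs_le {x y : OrliczSpace M} (h : ∀ n, |coord x n| ≤ |coord y n|) :
    ‖x‖ ≤ ‖y‖ :=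
  norm_le_norm_of_modular_le fun r => M.modular_mono fun n => by
    simp only [Pi.smul_apply, smul_eq_mul, abs_mul]
    exact mul_le_mul_of_nonneg_left (h n) (abs_nonneg _)

theorem modular_le_of_norm_le {x : OrliczSpace M} {r : ℝ} (hr : 0 < r) (hr1 : r ≤ 1)
    (h : ‖x‖ ≤ r) : M.modular (coord x) ≤ ENNReal.ofReal r := by
  have h1 := M.modular_smul_le (r⁻¹ • coord x) hr.le hr1
  rw [smul_smul, mul_inv_cancel₀ hr.ne', one_smul] at h1
  refine h1.trans ?_
  exact mul_le_of_le_one_right' ((norm_le_iff x hr).1 h)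

-- If `M(T) > 1`, a coordinate larger than `T * r` would alone push `Φ(x/r)` above 1.
variable (M) in
theorem exists_abs_coord_le : ∃ C : ℝ, 0 < C ∧ ∀ (x : OrliczSpace M) (n : ℕ),
    |coord x n| ≤ C * ‖x‖ := by
  obtain ⟨T, hT1, hT0⟩ := ((M.tendsto_atTop.eventually_gt_atTop 1).and
    (Filter.eventually_gt_atTop 0)).exists
  refine ⟨T, hT0, fun x n => ?_⟩
  have key : ∀ r : ℝ, ‖x‖ < r → |coord x n| ≤ T * r := by
    intro r hxr
    have hr : 0 < r := (norm_nonneg x).trans_lt hxr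
    have h := (M.modular_le_one_iff _).1 ((norm_le_iff x hr).1 hxr.le) {n}
    rw [Finset.sum_singleton] at h
    by_contra! hlt
    have h2 : T ≤ |(r⁻¹ • coord x) n| := by
      simp only [Pi.smul_apply, smul_eq_mul, abs_mul, abs_inv, abs_of_pos hr]
      rw [inv_mul_eq_div, le_div_iff₀ hr]
      exact hlt.le
    have h3 := M.monotoneOn (Set.mem_Ici.2 hT0.le) (Set.mem_Ici.2 (abs_nonneg _)) h2
    linarith
  refine le_of_forall_pos_le_add fun ε hε => ?_
  refine (key (‖x‖ + ε / T) (by linarith [div_pos hε hT0])).trans_eq ?_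
  field_simp

instance : CompleteSpace (OrliczSpace M) := by
  refine Metric.complete_of_cauchySeq_tendsto fun u hu => ?_
  obtain ⟨C, hC, hcoord⟩ := exists_abs_coord_le M
  have hcau : ∀ n, CauchySeq fun i => coord (u i) n := by
    intro n
    rw [Metric.cauchySeq_iff] at hu ⊢
    intro ε hε
    obtain ⟨N, hN⟩ := hu (ε / C) (div_pos hε hC)
    refine ⟨N, fun i hi j hj => ?_⟩
    have h1 := hcoord (u i - u j) n
    have h2 := hN i hi j hj
    rw [dist_eq_norm, lt_div_iff₀' hC] at h2
    rw [map_sub, Pi.sub_apply] at h1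
    rw [Real.dist_eq]
    exact h1.trans_lt h2
  choose x hx using fun n => cauchySeq_tendsto_of_complete (hcau n)
  have key : ∀ ε : ℝ, 0 < ε → ∃ N, ∀ i ≥ N, M.modular (ε⁻¹ • (coord (u i) - x)) ≤ 1 := by
    intro ε hε
    obtain ⟨N, hN⟩ := Metric.cauchySeq_iff.1 hu ε hε
    refine ⟨N, fun i hi => ?_⟩
    refine M.modular_le_one_of_tendsto (l := Filter.atTop)
      (u := fun j => ε⁻¹ • coord (u i - u j)) (fun n => ?_) ?_
    · simp only [Pi.smul_apply, smul_eq_mul, map_sub, Pi.sub_apply]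
      exact ((hx n).const_sub _).const_mul _
    · filter_upwards [Filter.eventually_ge_atTop N] with j hj
      have h2 := hN i hi j hj
      rw [dist_eq_norm] at h2
      exact (norm_le_iff _ hε).1 h2.le
  -- The coordinatewise limit `x` is not yet known to lie in `ℓ_M`, but `u N - x` is, by `key`; the
  -- limit is recovered as `u N - w`.
  obtain ⟨N, hN⟩ := key 1 one_pos
  obtain ⟨w, hw⟩ := exists_coord_eq (M := M) one_pos ((hN N le_rfl).trans_lt ENNReal.one_lt_top)
  refine ⟨u N - w, Metric.tendsto_atTop.2 fun ε hε => ?_⟩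
  obtain ⟨K, hK⟩ := key (ε / 2) (half_pos hε)
  refine ⟨K, fun i hi => ?_⟩
  rw [dist_eq_norm]
  refine lt_of_le_of_lt ((norm_le_iff _ (half_pos hε)).2 ?_) (half_lt_self hε)
  rw [map_sub, map_sub, hw, sub_sub_cancel]
  exact hK i hi

/-! ### The subspace `h_M` -/

theorem coord_unitVec (n : ℕ) : coord (unitVec M n) = Pi.single n 1 := rfl

theorem hCoord_apply (x : hSpace M) : hCoord M x = coord (x : OrliczSpace M) := rfl

theorem hCoord_hUnitVec (n : ℕ) : hCoord M (hUnitVec M n) = Pi.single n 1 := rfl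

theorem hCoord_injective : Function.Injective (hCoord M) :=
  coord_injective.comp Subtype.val_injective

theorem coord_sum_unitVec (s : Finset ℕ) (a : ℕ → ℝ) :
    coord (∑ n ∈ s, a n • unitVec M n) = fun n => if n ∈ s then a n else 0 := by
  funext m
  simp [map_sum, coord_unitVec, Finset.sum_apply, Pi.single_apply]

theorem hCoord_sum (s : Finset ℕ) (a : ℕ → ℝ) :
    hCoord M (∑ n ∈ s, a n • hUnitVec M n) = fun n => if n ∈ s then a n else 0 := by
  funext m
  simp [map_sum, hCoord_hUnitVec, Finset.sum_apply, Pi.single_apply]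

/-- Approximate `x` within `1/(2L)` by a finitely supported `y`. Then `Lx` is the midpoint of `2L(x
- y)`, of modular at most 1, and `2Ly`, of finite modular; convexity concludes. -/
theorem modular_smul_lt_top_of_mem {x : OrliczSpace M} (hx : x ∈ hSpace M) (K : ℝ) :
    M.modular (K • coord x) < ∞ := by
  set L : ℝ := |K| + 1
  have hL : 0 < L := by positivity
  refine (M.modular_smul_mono _ (show |K| ≤ |L| by rw [abs_of_pos hL]; simp [L])).trans_lt ?_
  obtain ⟨y, hy, hxy⟩ := Metric.mem_closure_iff.1
    (show x ∈ closure (Submodule.span ℝ (Set.range (unitVec M)) : Set (OrliczSpace M)) from hx)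
    (2 * L)⁻¹ (by positivity)
  have hy' : ∃ s : Finset ℕ, ∀ n ∉ s, coord y n = 0 := by
    refine Submodule.span_induction ?_ ⟨∅, by simp⟩ ?_ ?_ hy
    · rintro _ ⟨n, rfl⟩
      exact ⟨{n}, fun m hm => by simpa [coord_unitVec, Pi.single_apply] using hm⟩
    · rintro a b _ _ ⟨s, hs⟩ ⟨t, ht⟩
      refine ⟨s ∪ t, fun n hn => ?_⟩
      rw [Finset.mem_union, not_or] at hn
      simp [hs n hn.1, ht n hn.2]
    · rintro c a _ ⟨s, hs⟩
      exact ⟨s, fun n hn => by simp [hs n hn]⟩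
  obtain ⟨s, hs⟩ := hy'
  rw [dist_eq_norm] at hxy
  have h1 := (norm_le_iff _ (by positivity)).1 hxy.le
  rw [inv_inv] at h1
  have h2 : L • coord x = (1 / 2 : ℝ) • ((2 * L) • coord (x - y)) +
      (1 / 2 : ℝ) • ((2 * L) • coord y) := by
    rw [map_sub, smul_sub]
    module
  rw [h2]
  refine (M.modular_combo _ _ (by norm_num) (by norm_num) (by norm_num)).trans_lt ?_
  refine ENNReal.add_lt_top.2 ⟨ENNReal.mul_lt_top ENNReal.ofReal_lt_top
    (h1.trans_lt ENNReal.one_lt_top), ENNReal.mul_lt_top ENNReal.ofReal_lt_top ?_⟩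
  exact M.modular_finsupp_lt_top s fun n hn => by simp [hs n hn]

/-- The remainder of the expansion, scaled by `2/ε`, has as its modular the tail of a convergent
series; finiteness at every scale is what permits every `ε`. -/
theorem hasSum_unitVec {x : OrliczSpace M} (hx : ∀ K : ℝ, M.modular (K • coord x) < ∞) :
    HasSum (fun n => coord x n • unitVec M n) x := by
  refine Metric.tendsto_atTop.2 fun ε hε => ?_
  have hε2 := half_pos hε
  have h0 := ENNReal.tendsto_tsum_compl_atTop_zero (hx (ε / 2)⁻¹).ne
  obtain ⟨s₀, hs₀⟩ := Filter.eventually_atTop.1 (h0.eventually_le_const one_pos)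
  refine ⟨s₀, fun s hs => ?_⟩
  rw [dist_comm, dist_eq_norm]
  refine lt_of_le_of_lt ((norm_le_iff _ hε2).2 (le_trans (le_of_eq ?_) (hs₀ s hs)))
    (half_lt_self hε)
  rw [map_sub, coord_sum_unitVec]
  unfold OrliczFunction.modular
  rw [← tsum_subtype_eq_of_support_subset (s := {n | n ∉ s})]
  · refine tsum_congr fun n => ?_
    simp [show (n : ℕ) ∉ s from n.2]
  · intro n hn
    by_contra h
    rw [Set.mem_ofPred_eq, not_not] at h
    exact hn (by simp [h, M.map_zero])

theorem mem_hSpace_iff {x : OrliczSpace M} :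
    x ∈ hSpace M ↔ ∀ K : ℝ, M.modular (K • coord x) < ∞ := by
  refine ⟨modular_smul_lt_top_of_mem, fun h => ?_⟩
  refine mem_closure_of_tendsto (hasSum_unitVec h) (Filter.Eventually.of_forall fun s => ?_)
  exact Submodule.sum_mem _ fun n _ => Submodule.smul_mem _ _ (Submodule.subset_span ⟨n, rfl⟩)

theorem exists_hCoord_eq {x : ℕ → ℝ} (h : ∀ K : ℝ, M.modular (K • x) < ∞) :
    ∃ z : hSpace M, hCoord M z = x := by
  obtain ⟨z, rfl⟩ := exists_coord_eq (M := M) one_pos (h 1⁻¹)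
  exact ⟨⟨z, mem_hSpace_iff.2 h⟩, rfl⟩

theorem modular_smul_hCoord_lt_top (x : hSpace M) (K : ℝ) : M.modular (K • hCoord M x) < ∞ :=
  mem_hSpace_iff.1 x.2 K

theorem hNorm_le_one_iff (x : hSpace M) : ‖x‖ ≤ 1 ↔ M.modular (hCoord M x) ≤ 1 :=
  norm_le_one_iff (x : OrliczSpace M)

theorem hNorm_le_iff (x : hSpace M) {r : ℝ} (hr : 0 < r) :
    ‖x‖ ≤ r ↔ M.modular (r⁻¹ • hCoord M x) ≤ 1 :=
  norm_le_iff (x : OrliczSpace M) hr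

theorem hNorm_le_hNorm_of_abs_le {x y : hSpace M} (h : ∀ n, |hCoord M x n| ≤ |hCoord M y n|) :
    ‖x‖ ≤ ‖y‖ :=
  norm_le_norm_of_abs_le (x := (x : OrliczSpace M)) (y := (y : OrliczSpace M)) h

/-! ### The symmetric basis and the lattice structure of `h_M`. -/

theorem hasSum_hUnitVec (x : hSpace M) : HasSum (fun n => hCoord M x n • hUnitVec M n) x := by
  rw [← Topology.IsInducing.subtypeVal.hasSum_iff (g := (hSpace M).subtype)]
  exact hasSum_unitVec (mem_hSpace_iff.1 x.2)

instance : CompleteSpace (hSpace M) :=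
  (Submodule.isClosed_topologicalClosure _).completeSpace_coe

/-- The `n`-th coordinate functional on `h_M`. -/
noncomputable def hCoordCLM (M : OrliczFunction) (n : ℕ) : StrongDual ℝ (hSpace M) :=
  (LinearMap.proj n ∘ₗ hCoord M).mkContinuous (exists_abs_coord_le M).choose
    fun x => (exists_abs_coord_le M).choose_spec.2 x n

@[simp]
theorem hCoordCLM_apply (n : ℕ) (x : hSpace M) : hCoordCLM M n x = hCoord M x n := rfl

theorem isUnconditionalBasis_hUnitVec : IsUnconditionalBasis (hUnitVec M) := by
  intro x
  refine ⟨_, hasSum_hUnitVec x, fun a ha => funext fun m => ?_⟩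
  have h := ha.mapL (hCoordCLM M m)
  simp only [map_smul, hCoordCLM_apply, hCoord_hUnitVec] at h
  have h' := (hasSum_single (f := fun n => a n • (Pi.single n 1 : ℕ → ℝ) m) m
    fun n hn => by simp [hn.symm]).unique h
  simpa using h'

theorem hCoord_of_hasSum {a : ℕ → ℝ} {x : hSpace M}
    (h : HasSum (fun n => a n • hUnitVec M n) x) : hCoord M x = a :=
  (isUnconditionalBasis_hUnitVec x).unique (hasSum_hUnitVec x) h

theorem isOneSymmetricBasis_hUnitVec : IsOneSymmetricBasis (hUnitVec M) := by
  refine ⟨⟨isUnconditionalBasis_hUnitVec, fun F a b hab => ?_⟩, fun x a π hx => ?_⟩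
  · refine hNorm_le_hNorm_of_abs_le fun n => ?_
    rw [hCoord_sum, hCoord_sum]
    by_cases hn : n ∈ F <;> simp [hn, hab]
  · obtain rfl := hCoord_of_hasSum hx
    -- Permuting coordinates preserves the modular at every scale, hence both membership in `h_M`
    -- and the norm.
    have hmod : ∀ K : ℝ, M.modular (K • fun n => hCoord M x (π n)) =
        M.modular (K • hCoord M x) := fun K =>
      π.tsum_eq fun n => ENNReal.ofReal (M.toFun |(K • hCoord M x) n|)
    obtain ⟨y, hy⟩ := exists_hCoord_eq (M := M) (x := fun n => hCoord M x (π n)) fun K => by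
      rw [hmod]
      exact modular_smul_hCoord_lt_top x K
    refine ⟨y, ?_, le_antisymm ?_ ?_⟩
    · have := hasSum_hUnitVec y
      rwa [hy] at this
    · refine norm_le_norm_of_modular_le (x := (y : OrliczSpace M)) (y := (x : OrliczSpace M))
        fun r => ?_
      rw [← hCoord_apply, ← hCoord_apply, hy, hmod]
    · refine norm_le_norm_of_modular_le (x := (x : OrliczSpace M)) (y := (y : OrliczSpace M))
        fun r => ?_
      rw [← hCoord_apply, ← hCoord_apply, hy, hmod]

theorem norm_hUnitVec (h1 : M.toFun 1 = 1) (h : ∀ t, 1 < t → 1 < M.toFun t) (n : ℕ) :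
    ‖hUnitVec M n‖ = 1 := by
  have hmod : ∀ r : ℝ, 0 < r → M.modular (r • hCoord M (hUnitVec M n)) =
      ENNReal.ofReal (M.toFun r) := by
    intro r hr
    rw [hCoord_hUnitVec]
    have h2 := M.modular_indicator_const {n} r
    rw [abs_of_pos hr, Finset.card_singleton, Nat.cast_one, one_mul] at h2
    rw [← h2]
    congr 1
    funext m
    simp [Pi.single_apply]
  refine le_antisymm ?_ (le_of_forall_lt fun r hr => ?_)
  · rw [hNorm_le_iff _ one_pos, hmod _ (by positivity)]
    simp [h1]
  · rcases le_or_gt r 0 with hr0 | hr0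
    · refine hr0.trans_lt (norm_pos_iff.2 fun h0 => ?_)
      have := hmod 1 one_pos
      rw [h0, map_zero, smul_zero, M.modular_zero, h1] at this
      simp at this
    · rw [← not_le, hNorm_le_iff _ hr0, hmod _ (by positivity), ENNReal.ofReal_le_one, not_le]
      exact h _ ((one_lt_inv₀ hr0).2 hr)

theorem isSolidBanachLattice_hCoord (h1 : M.toFun 1 = 1) (h : ∀ t, 1 < t → 1 < M.toFun t) :
    IsSolidBanachLattice (hCoord M) where
  complete := inferInstance
  injective := hCoord_injective
  bounded x := by
    obtain ⟨C, -, hC⟩ := exists_abs_coord_le M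
    exact ⟨_, hC x⟩
  solid x y hxy := by
    obtain ⟨z, rfl⟩ := exists_hCoord_eq (M := M) (x := y) fun K =>
      (M.modular_mono fun n => by
        simp only [Pi.smul_apply, smul_eq_mul, abs_mul]
        exact mul_le_mul_of_nonneg_left (hxy n) (abs_nonneg _)).trans_lt
          (modular_smul_hCoord_lt_top x K)
    exact ⟨z, rfl, hNorm_le_hNorm_of_abs_le hxy⟩
  unit n := ⟨hUnitVec M n, hCoord_hUnitVec n, norm_hUnitVec h1 h n⟩

/-! ### Strict convexity -/

/-- Membership in `h_M` makes `Φ(2x)` finite, so convexity between `x` and `2x` keeps `Φ((1+s)x) ≤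
1` for some `s > 0`. -/
theorem hNorm_lt_one_of_modular_lt_one {x : hSpace M} (h : M.modular (hCoord M x) < 1) :
    ‖x‖ < 1 := by
  set a := (M.modular (hCoord M x)).toReal with ha
  set b := (M.modular ((2 : ℝ) • hCoord M x)).toReal with hb
  have ha1 : a < 1 := by
    rw [ha, ← ENNReal.toReal_one]
    exact (ENNReal.toReal_lt_toReal h.ne_top ENNReal.one_ne_top).2 h
  have hb0 : 0 ≤ b := ENNReal.toReal_nonneg
  have ha0 : 0 ≤ a := ENNReal.toReal_nonneg
  -- Chosen so that `s ≤ 1` and `s * b ≤ 1 - a`, whence `(1 - s) * a + s * b ≤ 1`.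
  set s : ℝ := (1 - a) / (1 + b) with hs
  have hs0 : 0 < s := div_pos (by linarith) (by linarith)
  have hs1 : s ≤ 1 := (div_le_one (by linarith)).2 (by linarith)
  have hsb : s * b ≤ 1 - a := by
    rw [hs, div_mul_eq_mul_div, div_le_iff₀ (by linarith)]
    nlinarith
  have key : M.modular ((1 + s) • hCoord M x) ≤ 1 := by
    have h2 : (1 + s) • hCoord M x = (1 - s) • hCoord M x + s • ((2 : ℝ) • hCoord M x) := by
      module
    rw [h2]
    refine (M.modular_combo _ _ (by linarith) hs0.le (by ring)).trans ?_
    rw [← ENNReal.ofReal_toReal h.ne_top,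
      ← ENNReal.ofReal_toReal (modular_smul_hCoord_lt_top x 2).ne, ← ENNReal.ofReal_mul
      (by linarith), ← ENNReal.ofReal_mul hs0.le, ← ENNReal.ofReal_add
      (mul_nonneg (by linarith) ha0) (mul_nonneg hs0.le hb0), ENNReal.ofReal_le_one]
    change (1 - s) * a + s * b ≤ 1
    nlinarith
  have h3 : ‖x‖ ≤ (1 + s)⁻¹ := by
    rw [hNorm_le_iff _ (by positivity), inv_inv]
    exact key
  exact h3.trans_lt (inv_lt_one_of_one_lt₀ (by linarith))

theorem modular_eq_one_of_hNorm_eq_one {x : hSpace M} (h : ‖x‖ = 1) :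
    M.modular (hCoord M x) = 1 := by
  refine le_antisymm ((hNorm_le_one_iff x).1 h.le) (not_lt.1 fun hlt => ?_)
  exact (hNorm_lt_one_of_modular_lt_one hlt).ne h

/-- Distinct unit vectors both have modular 1 and differ at some coordinate. Strict convexity there
gives their midpoint modular below 1, hence norm below 1. -/
theorem strictConvexSpace_hSpace (hM : StrictConvexOn ℝ Set.univ fun t => M.toFun |t|) :
    StrictConvexSpace ℝ (hSpace M) := by
  refine StrictConvexSpace.of_norm_add_ne_two fun x y hx hy hxy => ?_
  have hlt : ‖(1 / 2 : ℝ) • x + (1 / 2 : ℝ) • y‖ < 1 := by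
    refine hNorm_lt_one_of_modular_lt_one ?_
    have hxy' : ∃ n, hCoord M x n ≠ hCoord M y n := by
      by_contra! h
      exact hxy (hCoord_injective (funext h))
    obtain ⟨n, hn⟩ := hxy'
    have hterm : ∀ m, M.toFun |hCoord M ((1 / 2 : ℝ) • x + (1 / 2 : ℝ) • y) m| ≤
        1 / 2 * M.toFun |hCoord M x m| + 1 / 2 * M.toFun |hCoord M y m| := fun m => by
      simpa using hM.convexOn.2 (Set.mem_univ (hCoord M x m)) (Set.mem_univ (hCoord M y m))
        (show (0 : ℝ) ≤ 1 / 2 by norm_num) (show (0 : ℝ) ≤ 1 / 2 by norm_num) (by norm_num)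
    have hstrict : M.toFun |hCoord M ((1 / 2 : ℝ) • x + (1 / 2 : ℝ) • y) n| <
        1 / 2 * M.toFun |hCoord M x n| + 1 / 2 * M.toFun |hCoord M y n| := by
      simpa using hM.2 (Set.mem_univ (hCoord M x n)) (Set.mem_univ (hCoord M y n)) hn
        (show (0 : ℝ) < 1 / 2 by norm_num) (show (0 : ℝ) < 1 / 2 by norm_num) (by norm_num)
    have hsum : ∑' m, ENNReal.ofReal (1 / 2 * M.toFun |hCoord M x m| +
        1 / 2 * M.toFun |hCoord M y m|) = 1 := by
      have h1 := modular_eq_one_of_hNorm_eq_one hx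
      have h2 := modular_eq_one_of_hNorm_eq_one hy
      unfold OrliczFunction.modular at h1 h2
      have h3 : ∀ m, ENNReal.ofReal (1 / 2 * M.toFun |hCoord M x m| +
          1 / 2 * M.toFun |hCoord M y m|) = ENNReal.ofReal (1 / 2) *
          ENNReal.ofReal (M.toFun |hCoord M x m|) + ENNReal.ofReal (1 / 2) *
          ENNReal.ofReal (M.toFun |hCoord M y m|) := fun m => by
        have hx0 := M.nonneg (abs_nonneg (hCoord M x m))
        have hy0 := M.nonneg (abs_nonneg (hCoord M y m))
        rw [ENNReal.ofReal_add (by positivity) (by positivity), ENNReal.ofReal_mul (by norm_num),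
          ENNReal.ofReal_mul (by norm_num)]
      rw [tsum_congr h3, ENNReal.tsum_add, ENNReal.tsum_mul_left, ENNReal.tsum_mul_left, h1, h2,
        mul_one, ← ENNReal.ofReal_add (by norm_num) (by norm_num)]
      norm_num
    refine lt_of_lt_of_eq (ENNReal.tsum_lt_tsum (i := n) ?_
      (fun m => ENNReal.ofReal_le_ofReal (hterm m)) ?_) hsum
    · exact ne_top_of_le_ne_top ENNReal.one_ne_top
        ((ENNReal.tsum_le_tsum fun m => ENNReal.ofReal_le_ofReal (hterm m)).trans hsum.le)
    · exact (ENNReal.ofReal_lt_ofReal_iff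
        ((M.nonneg (abs_nonneg _)).trans_lt hstrict)).2 hstrict
  rw [← smul_add, norm_smul, Real.norm_of_nonneg (by norm_num)] at hlt
  intro h
  rw [h] at hlt
  norm_num at hlt

end OrliczSpace

namespace OrliczSpace

variable {M : OrliczFunction}

/-! ### Coordinate projections and shrinking bases -/

/-- The projection of `h_M` onto the coordinates in `s`. -/
noncomputable def hProj (M : OrliczFunction) (s : Finset ℕ) : hSpace M →L[ℝ] hSpace M :=
  ∑ n ∈ s, (hCoordCLM M n).smulRight (hUnitVec M n)

theorem hProj_apply (s : Finset ℕ) (x : hSpace M) :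
    hProj M s x = ∑ n ∈ s, hCoord M x n • hUnitVec M n := by
  simp [hProj]

theorem hCoord_hProj (s : Finset ℕ) (x : hSpace M) :
    hCoord M (hProj M s x) = fun n => if n ∈ s then hCoord M x n else 0 := by
  rw [hProj_apply, hCoord_sum]

theorem norm_hProj_apply_le (s : Finset ℕ) (x : hSpace M) : ‖hProj M s x‖ ≤ ‖x‖ :=
  hNorm_le_hNorm_of_abs_le fun n => by
    rw [hCoord_hProj]
    by_cases hn : n ∈ s <;> simp [hn]

theorem norm_sub_hProj_apply_le (s : Finset ℕ) (x : hSpace M) : ‖x - hProj M s x‖ ≤ ‖x‖ :=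
  hNorm_le_hNorm_of_abs_le fun n => by
    rw [map_sub, hCoord_hProj]
    by_cases hn : n ∈ s <;> simp [hn]

theorem tendsto_hProj (x : hSpace M) :
    Filter.Tendsto (fun s => hProj M s x) Filter.atTop (nhds x) := by
  simp only [hProj_apply]
  exact hasSum_hUnitVec x

theorem norm_comp_hProj_le (f : StrongDual ℝ (hSpace M)) (s : Finset ℕ) :
    ‖f.comp (hProj M s)‖ ≤ ‖f‖ :=
  ContinuousLinearMap.opNorm_le_bound _ (norm_nonneg _) fun x =>
    (f.le_opNorm _).trans (mul_le_mul_of_nonneg_left (norm_hProj_apply_le s x) (norm_nonneg _))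

/-- Almost norming vectors are taken in the open ball, which later leaves room in the modular for a
disjoint summand. -/
theorem exists_norm_lt_one_lt_apply {X : Type*} [NormedAddCommGroup X] [NormedSpace ℝ X]
    (f : StrongDual ℝ X) {c : ℝ} (hc : c < ‖f‖) : ∃ x : X, ‖x‖ < 1 ∧ c < f x := by
  obtain ⟨x, hx, hfx⟩ := f.exists_lt_apply_of_lt_opNorm hc
  rw [Real.norm_eq_abs, lt_abs] at hfx
  rcases hfx with h | h
  · exact ⟨x, hx, h⟩
  · exact ⟨-x, by rwa [norm_neg], by rwa [map_neg]⟩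

/-- The norm of a functional is recovered along the coordinate projections. -/
theorem tendsto_norm_comp_hProj (f : StrongDual ℝ (hSpace M)) :
    Filter.Tendsto (fun s => ‖f.comp (hProj M s)‖) Filter.atTop (nhds ‖f‖) := by
  refine tendsto_order.2 ⟨fun c hc => ?_, fun c hc =>
    Filter.Eventually.of_forall fun s => (norm_comp_hProj_le f s).trans_lt hc⟩
  obtain ⟨x, hx, hfx⟩ := exists_norm_lt_one_lt_apply f hc
  filter_upwards [((f.continuous.tendsto _).comp (tendsto_hProj x)).eventually_const_lt hfx]
    with s hs
  refine lt_of_lt_of_le hs ((le_abs_self _).trans ?_)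
  refine ((f.comp (hProj M s)).le_opNorm x).trans ?_
  exact mul_le_of_le_one_right (norm_nonneg _) hx.le

/-- The upper `2`-estimate for disjoint vectors, under quadratic growth of `M`. -/
theorem sq_norm_add_le_of_disjoint
    (hM : ∀ a t : ℝ, 0 ≤ a → a ≤ 1 → 0 ≤ t → M.toFun (a * t) ≤ a ^ 2 * M.toFun t)
    {x y : hSpace M} (h : ∀ n, hCoord M x n = 0 ∨ hCoord M y n = 0) {a b : ℝ} (ha : 0 < a)
    (hb : 0 < b) (hx : ‖x‖ ≤ a) (hy : ‖y‖ ≤ b) : ‖x + y‖ ≤ √(a ^ 2 + b ^ 2) := by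
  set r := √(a ^ 2 + b ^ 2)
  have hr2 : r ^ 2 = a ^ 2 + b ^ 2 := Real.sq_sqrt (by positivity)
  have hr : 0 < r := by positivity
  have hscale : ∀ (z : hSpace M) (c : ℝ), 0 < c → c ≤ r → ‖z‖ ≤ c →
      M.modular (r⁻¹ • hCoord M z) ≤ ENNReal.ofReal ((c / r) ^ 2) := by
    intro z c hc hcr hz
    refine le_trans ?_ (mul_le_of_le_one_right' ((hNorm_le_iff z hc).1 hz))
    unfold OrliczFunction.modular
    rw [← ENNReal.tsum_mul_left]
    refine ENNReal.tsum_le_tsum fun n => ?_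
    rw [← ENNReal.ofReal_mul (by positivity)]
    refine ENNReal.ofReal_le_ofReal ?_
    -- Passing from scale `c` to the larger scale `r` gains the factor `(c/r)²`; the gains for `a`
    -- and `b` sum to 1.
    convert hM (c / r) |(c⁻¹ • hCoord M z) n| (by positivity) ((div_le_one hr).2 hcr)
      (abs_nonneg _) using 2
    simp only [Pi.smul_apply, smul_eq_mul, abs_mul, abs_inv, abs_of_pos hr, abs_of_pos hc]
    field_simp
  rw [hNorm_le_iff _ hr, map_add, smul_add, M.modular_add_of_disjoint fun n => by
    rcases h n with h | h <;> simp [h]]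
  refine (add_le_add
    (hscale x a ha (Real.le_sqrt_of_sq_le (by nlinarith)) hx)
    (hscale y b hb (Real.le_sqrt_of_sq_le (by nlinarith)) hy)).trans ?_
  rw [← ENNReal.ofReal_add (by positivity) (by positivity), ENNReal.ofReal_le_one, div_pow,
    div_pow, ← add_div, ← hr2, div_self (by positivity)]

/-- The dual lower 2-estimate: test `f` on a disjoint sum of vectors almost norming its two
restrictions, and bound that sum by the upper 2-estimate. -/
theorem norm_sub_comp_hProj_sq_le
    (hM : ∀ a t : ℝ, 0 ≤ a → a ≤ 1 → 0 ≤ t → M.toFun (a * t) ≤ a ^ 2 * M.toFun t)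
    (f : StrongDual ℝ (hSpace M)) (s : Finset ℕ) :
    ‖f - f.comp (hProj M s)‖ ^ 2 ≤ ‖f‖ ^ 2 - ‖f.comp (hProj M s)‖ ^ 2 := by
  set g := f.comp (hProj M s)
  set k := f - g
  -- `c` and `d` serve both as lower bounds for the restrictions and as weights of the test vectors,
  -- the equality case of Cauchy–Schwarz.
  have key : ∀ c d : ℝ, 0 < c → c < ‖g‖ → 0 < d → d < ‖k‖ → c ^ 2 + d ^ 2 ≤ ‖f‖ ^ 2 := by
    intro c d hc0 hc hd0 hd
    obtain ⟨x, hx, hgx⟩ := exists_norm_lt_one_lt_apply g hc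
    obtain ⟨y, hy, hky⟩ := exists_norm_lt_one_lt_apply k hd
    have h1 : ‖c • hProj M s x + d • (y - hProj M s y)‖ ≤ √(c ^ 2 + d ^ 2) := by
      refine sq_norm_add_le_of_disjoint hM (fun n => ?_) hc0 hd0 ?_ ?_
      · simp only [map_smul, map_sub, hCoord_hProj, Pi.smul_apply, Pi.sub_apply]
        by_cases hn : n ∈ s <;> simp [hn]
      · rw [norm_smul, Real.norm_of_nonneg hc0.le]
        exact mul_le_of_le_one_right hc0.le ((norm_hProj_apply_le s x).trans hx.le)
      · rw [norm_smul, Real.norm_of_nonneg hd0.le]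
        exact mul_le_of_le_one_right hd0.le ((norm_sub_hProj_apply_le s y).trans hy.le)
    have h2 : f (c • hProj M s x + d • (y - hProj M s y)) = c * g x + d * k y := by
      simp [g, k]
    have h3 : c ^ 2 + d ^ 2 ≤ ‖f‖ * √(c ^ 2 + d ^ 2) := by
      calc c ^ 2 + d ^ 2 ≤ c * g x + d * k y := by nlinarith
        _ ≤ ‖f (c • hProj M s x + d • (y - hProj M s y))‖ := h2 ▸ le_abs_self _
        _ ≤ _ := (f.le_opNorm _).trans (mul_le_mul_of_nonneg_left h1 (norm_nonneg _))
    have h4 : √(c ^ 2 + d ^ 2) ^ 2 = c ^ 2 + d ^ 2 := Real.sq_sqrt (by positivity)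
    have h5 : 0 < √(c ^ 2 + d ^ 2) := by positivity
    have h6 : √(c ^ 2 + d ^ 2) ≤ ‖f‖ := by
      refine le_of_mul_le_mul_right ?_ h5
      rw [← pow_two, h4]
      exact h3
    rw [← h4]
    exact pow_le_pow_left₀ h5.le h6 2
  have hgf : ‖g‖ ≤ ‖f‖ := norm_comp_hProj_le f s
  have hkf : ‖k‖ ≤ ‖f‖ := ContinuousLinearMap.opNorm_le_bound _ (norm_nonneg _) fun x => by
    have : k x = f (x - hProj M s x) := by simp [k, g]
    rw [this]
    exact (f.le_opNorm _).trans
      (mul_le_mul_of_nonneg_left (norm_sub_hProj_apply_le s x) (norm_nonneg _))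
  rcases (norm_nonneg g).eq_or_lt with hg0 | hg0
  · rw [← hg0]
    simpa using pow_le_pow_left₀ (norm_nonneg _) hkf 2
  rcases (norm_nonneg k).eq_or_lt with hk0 | hk0
  · rw [← hk0]
    have := pow_le_pow_left₀ (norm_nonneg _) hgf 2
    linarith
  have hlim : Filter.Tendsto (fun θ : ℝ => (θ * ‖g‖) ^ 2 + (θ * ‖k‖) ^ 2)
      (nhdsWithin 1 (Set.Iio 1)) (nhds ((1 * ‖g‖) ^ 2 + (1 * ‖k‖) ^ 2)) :=
    (Continuous.tendsto (by fun_prop) 1).mono_left nhdsWithin_le_nhds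
  have h := le_of_tendsto hlim (b := ‖f‖ ^ 2) <| by
    filter_upwards [Ioo_mem_nhdsLT (zero_lt_one' ℝ)] with θ hθ
    exact key _ _ (mul_pos hθ.1 hg0) (mul_lt_of_lt_one_left hg0 hθ.2) (mul_pos hθ.1 hk0)
      (mul_lt_of_lt_one_left hk0 hθ.2)
  rw [one_mul, one_mul] at h
  linarith

/-- Every functional on `h_M` is the norm limit of its restrictions to finitely many
coordinates. -/
theorem tendsto_comp_hProj
    (hM : ∀ a t : ℝ, 0 ≤ a → a ≤ 1 → 0 ≤ t → M.toFun (a * t) ≤ a ^ 2 * M.toFun t)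
    (f : StrongDual ℝ (hSpace M)) :
    Filter.Tendsto (fun s => f.comp (hProj M s)) Filter.atTop (nhds f) := by
  rw [tendsto_iff_norm_sub_tendsto_zero]
  have h1 : Filter.Tendsto (fun s => √(‖f‖ ^ 2 - ‖f.comp (hProj M s)‖ ^ 2)) Filter.atTop
      (nhds 0) := by
    have := (((tendsto_norm_comp_hProj f).pow 2).const_sub (‖f‖ ^ 2)).sqrt
    simpa using this
  refine squeeze_zero (fun s => norm_nonneg _) (fun s => ?_) h1
  rw [norm_sub_rev]
  exact Real.le_sqrt_of_sq_le (norm_sub_comp_hProj_sq_le hM f s)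

/-! ### The bidual -/

/-- The finite part `∑_{n ∈ s} z(e_n^*) e_n` of an element of the bidual. -/
noncomputable def bidualTrunc (z : StrongDual ℝ (StrongDual ℝ (hSpace M))) (s : Finset ℕ) :
    hSpace M :=
  ∑ n ∈ s, z (hCoordCLM M n) • hUnitVec M n

/-- The truncation is the second adjoint of the finite-rank projection `hProj M s` applied to `z`,
so it lands in `h_M`. -/
theorem apply_bidualTrunc (z : StrongDual ℝ (StrongDual ℝ (hSpace M))) (s : Finset ℕ)
    (f : StrongDual ℝ (hSpace M)) : f (bidualTrunc z s) = z (f.comp (hProj M s)) := by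
  have h : f.comp (hProj M s) = ∑ n ∈ s, f (hUnitVec M n) • hCoordCLM M n := by
    ext x
    simp [hProj_apply, mul_comm]
  rw [h]
  simp [bidualTrunc, mul_comm]

theorem hCoord_bidualTrunc (z : StrongDual ℝ (StrongDual ℝ (hSpace M))) (s : Finset ℕ) :
    hCoord M (bidualTrunc z s) = fun n => if n ∈ s then z (hCoordCLM M n) else 0 :=
  hCoord_sum s _

theorem norm_bidualTrunc_le (z : StrongDual ℝ (StrongDual ℝ (hSpace M))) (s : Finset ℕ) :
    ‖bidualTrunc z s‖ ≤ ‖z‖ := by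
  refine NormedSpace.norm_le_dual_bound ℝ _ (norm_nonneg _) fun f => ?_
  rw [apply_bidualTrunc]
  exact (z.le_opNorm _).trans (mul_le_mul_of_nonneg_left (norm_comp_hProj_le f s) (norm_nonneg _))

/-- The truncations stay in the unit ball of `h_M` and converge coordinatewise, so semicontinuity
applies. -/
theorem modular_le_one_of_bidual_norm_le_one {z : StrongDual ℝ (StrongDual ℝ (hSpace M))}
    (hz : ‖z‖ ≤ 1) : M.modular (fun n => z (hCoordCLM M n)) ≤ 1 := by
  refine M.modular_le_one_of_tendsto (l := Filter.atTop)
    (u := fun s : Finset ℕ => hCoord M (bidualTrunc z s)) (fun n => ?_)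
    (Filter.Eventually.of_forall fun s =>
      (hNorm_le_one_iff _).1 ((norm_bidualTrunc_le z s).trans hz))
  refine tendsto_const_nhds.congr' ?_
  filter_upwards [Filter.eventually_ge_atTop {n}] with s hs
  simp [hCoord_bidualTrunc, Finset.singleton_subset_iff.1 hs]

/-- Because finite restrictions converge to `f` in norm, `z f` is the limit of `f` at the
truncations of `z`, which lie in the unit ball. -/
theorem bidual_norm_le_one_of_modular_le_one
    (hM : ∀ a t : ℝ, 0 ≤ a → a ≤ 1 → 0 ≤ t → M.toFun (a * t) ≤ a ^ 2 * M.toFun t)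
    {z : StrongDual ℝ (StrongDual ℝ (hSpace M))}
    (hz : M.modular (fun n => z (hCoordCLM M n)) ≤ 1) : ‖z‖ ≤ 1 := by
  refine ContinuousLinearMap.opNorm_le_bound _ zero_le_one fun f => ?_
  refine le_of_tendsto ((z.continuous.norm.tendsto f).comp (tendsto_comp_hProj hM f))
    (Filter.Eventually.of_forall fun s => ?_)
  rw [Function.comp_apply, ← apply_bidualTrunc, mul_comm]
  refine (f.le_opNorm _).trans (mul_le_mul_of_nonneg_left ?_ (norm_nonneg _))
  refine (hNorm_le_one_iff _).2 ((M.modular_mono fun n => ?_).trans hz)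
  rw [hCoord_bidualTrunc]
  by_cases hn : n ∈ s <;> simp [hn]

theorem modular_hCoord_lt_one {x : hSpace M} (hx : ‖x‖ < 1) : M.modular (hCoord M x) < 1 := by
  obtain ⟨r, hr, hr1⟩ := exists_between hx
  refine (modular_le_of_norm_le (x := (x : OrliczSpace M)) ((norm_nonneg x).trans_lt hr) hr1.le
    hr.le).trans_lt ?_
  rwa [ENNReal.ofReal_lt_one]

/-! ### The M-ideal property. -/

theorem norm_add_ge_of_annihilator
    (hM : ∀ a t : ℝ, 0 ≤ a → a ≤ 1 → 0 ≤ t → M.toFun (a * t) ≤ a ^ 2 * M.toFun t)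
    (f : StrongDual ℝ (hSpace M)) (g : StrongDual ℝ (StrongDual ℝ (StrongDual ℝ (hSpace M))))
    (hg : g ∈ annihilatorInTripleDual (hSpace M)) :
    ‖f‖ + ‖g‖ ≤ ‖NormedSpace.inclusionInDoubleDual ℝ (StrongDual ℝ (hSpace M)) f + g‖ := by
  set φ := NormedSpace.inclusionInDoubleDual ℝ (StrongDual ℝ (hSpace M)) f + g
  set J := NormedSpace.inclusionInDoubleDual ℝ (hSpace M)
  refine le_of_forall_pos_le_add fun ε hε => ?_
  obtain ⟨x, hx, hfx⟩ := exists_norm_lt_one_lt_apply f (c := ‖f‖ - ε / 2) (by linarith)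
  obtain ⟨z, hz, hgz⟩ := exists_norm_lt_one_lt_apply g (c := ‖g‖ - ε / 2) (by linarith)
  -- Head of `x`, tail of `z`: disjoint coordinates, so the modulars add.
  set w : Finset ℕ → StrongDual ℝ (StrongDual ℝ (hSpace M)) := fun s =>
    J (hProj M s x) + (z - J (bidualTrunc z s))
  have hmz : M.modular (fun n => z (hCoordCLM M n)) ≠ ∞ :=
    ((modular_le_one_of_bidual_norm_le_one hz.le).trans_lt ENNReal.one_lt_top).ne
  have hwcoord : ∀ s, M.modular (fun n => w s (hCoordCLM M n)) ≤ M.modular (hCoord M x) +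
      ∑' n : {n // n ∉ s}, ENNReal.ofReal (M.toFun |z (hCoordCLM M n)|) := by
    intro s
    have h1 : (fun n => w s (hCoordCLM M n)) = hCoord M (hProj M s x) +
        fun n => if n ∈ s then 0 else z (hCoordCLM M n) := by
      funext n
      simp only [w, J, _root_.add_apply, _root_.sub_apply, NormedSpace.dual_def, hCoordCLM_apply,
        hCoord_hProj, hCoord_bidualTrunc, Pi.add_apply]
      by_cases hn : n ∈ s <;> simp [hn]
    rw [h1, M.modular_add_of_disjoint fun n => by
      rw [hCoord_hProj]
      by_cases hn : n ∈ s <;> simp [hn]]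
    refine add_le_add (M.modular_mono fun n => ?_) (le_of_eq ?_)
    · rw [hCoord_hProj]
      by_cases hn : n ∈ s <;> simp [hn]
    · unfold OrliczFunction.modular
      rw [← tsum_subtype_eq_of_support_subset (s := {n | n ∉ s})]
      · refine tsum_congr fun n => ?_
        simp [show (n : ℕ) ∉ s from n.2]
      · intro n hn
        by_contra h
        rw [Set.mem_ofPred_eq, not_not] at h
        exact hn (by simp [h, M.map_zero])
  have hwnorm : ∀ᶠ s in Filter.atTop, ‖w s‖ ≤ 1 := by
    -- The tail of `Φ(z)` eventually fits into the room `1 - Φ(x) > 0`.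
    filter_upwards [(ENNReal.tendsto_tsum_compl_atTop_zero hmz).eventually_le_const
      (tsub_pos_of_lt (modular_hCoord_lt_one hx))] with s hs
    refine bidual_norm_le_one_of_modular_le_one hM ((hwcoord s).trans ?_)
    refine (add_le_add le_rfl hs).trans ?_
    rw [add_tsub_cancel_of_le (modular_hCoord_lt_one hx).le]
  have hval : ∀ s, φ (w s) = f (hProj M s x) + (z f - z (f.comp (hProj M s))) + g z := by
    intro s
    have h1 : g (w s) = g z := by
      simp only [w, map_add, map_sub]
      rw [hg, hg]
      simp
    rw [_root_.add_apply, h1, NormedSpace.dual_def]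
    simp only [w, J, _root_.add_apply, _root_.sub_apply, NormedSpace.dual_def, apply_bidualTrunc]
  have hlim : Filter.Tendsto (fun s => φ (w s)) Filter.atTop (nhds (f x + (z f - z f) + g z)) := by
    simp only [hval]
    exact (((f.continuous.tendsto _).comp (tendsto_hProj x)).add
      (((z.continuous.tendsto _).comp (tendsto_comp_hProj hM f)).const_sub _)).add_const _
  have h := le_of_tendsto hlim (b := ‖φ‖) <| by
    filter_upwards [hwnorm] with s hs
    exact (le_abs_self _).trans ((φ.le_opNorm _).trans
      (mul_le_of_le_one_right (norm_nonneg φ) hs))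
  linarith

/-- Restricting `φ` to `X` gives `f ∈ X*`, and `φ - f` kills `X`. Every normed space has this
splitting; only the additivity of norms is special. -/
theorem isCompl_dual_annihilator (X : Type*) [NormedAddCommGroup X] [NormedSpace ℝ X] :
    IsCompl (dualInTripleDual X) (annihilatorInTripleDual X) := by
  constructor
  · rw [Submodule.disjoint_def]
    rintro _ ⟨f, rfl⟩ hf
    have : f = 0 := by
      ext x
      exact hf x
    simp [this]
  · rw [codisjoint_iff, eq_top_iff]
    intro φ _
    set f : StrongDual ℝ X := φ.comp (NormedSpace.inclusionInDoubleDual ℝ X)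
    refine Submodule.mem_sup.2 ⟨_, ⟨f, rfl⟩, φ - NormedSpace.inclusionInDoubleDual ℝ _ f,
      fun x => ?_, by simp⟩
    simp [f]

theorem isMEmbedded_hSpace
    (hM : ∀ a t : ℝ, 0 ≤ a → a ≤ 1 → 0 ≤ t → M.toFun (a * t) ≤ a ^ 2 * M.toFun t) :
    IsMEmbedded (hSpace M) := by
  refine ⟨isCompl_dual_annihilator _, ?_⟩
  rintro _ ⟨f, rfl⟩ g hg
  refine le_antisymm (norm_add_le (E := StrongDual ℝ (StrongDual ℝ (StrongDual ℝ (hSpace M)))) _ _)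
    ?_
  refine le_trans (add_le_add ?_ le_rfl) (norm_add_ge_of_annihilator hM f g hg)
  exact NormedSpace.double_dual_bound ℝ _ f

/-! ### Flat vectors -/

/-- `M` fails the `Δ₂` condition at zero at every scale `c > 1`. -/
def FailsDeltaTwoAtZero (M : OrliczFunction) : Prop :=
  ∀ c K η : ℝ, 1 < c → 0 < K → 0 < η →
    ∃ t : ℝ, 0 < t ∧ 0 < M.toFun t ∧ M.toFun t ≤ η ∧ K * M.toFun t < M.toFun (c * t)

/-- Far out in `ℕ` there are constant vectors of small modular and norm nearly one. -/
theorem FailsDeltaTwoAtZero.exists_flat (h : FailsDeltaTwoAtZero M) {c η : ℝ} (hc : 1 < c)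
    (hη : 0 < η) : ∃ (t : ℝ) (N : ℕ), 0 < t ∧ ∀ A : Finset ℕ, A.card = N →
      M.modular (hCoord M (∑ n ∈ A, t • hUnitVec M n)) ≤ ENNReal.ofReal η ∧
      c⁻¹ ≤ ‖∑ n ∈ A, t • hUnitVec M n‖ := by
  -- With `N = ⌊η / M(t)⌋`, the bound `M(t) ≤ η/2` puts `N * M(t)` in `[η/2, η]`. The factor `2/η`
  -- then gives `N * M(ct) > 1`, so the norm is at least `1/c`.
  obtain ⟨t, ht, hMt, hMη, hlt⟩ := h c (2 / η) (η / 2) hc (by positivity) (by positivity)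
  refine ⟨t, ⌊η / M.toFun t⌋₊, ht, fun A hA => ?_⟩
  have hN1 : (A.card : ℝ) * M.toFun t ≤ η := by
    rw [hA, ← le_div_iff₀ hMt]
    exact Nat.floor_le (by positivity)
  have hN2 : η / 2 ≤ (A.card : ℝ) * M.toFun t := by
    have h1 := Nat.lt_floor_add_one (η / M.toFun t)
    rw [← hA, div_lt_iff₀ hMt] at h1
    linarith
  have hc0 : 0 < c := by linarith
  rw [hCoord_sum A fun _ => t, M.modular_indicator_const, abs_of_pos ht]
  refine ⟨ENNReal.ofReal_le_ofReal hN1, ?_⟩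
  by_contra! hlt'
  have h2 := (hNorm_le_iff _ (inv_pos.2 hc0)).1 hlt'.le
  have h3 : c⁻¹⁻¹ • (fun n => if n ∈ A then t else 0) = fun n => if n ∈ A then c * t else 0 := by
    funext n
    simp
  rw [hCoord_sum A fun _ => t, h3, M.modular_indicator_const, abs_of_pos (by positivity),
    ENNReal.ofReal_le_one] at h2
  have h4 : (0 : ℝ) < A.card := by
    by_contra! h0
    nlinarith
  have h5 : (1 : ℝ) ≤ A.card * (2 / η * M.toFun t) := by
    have : (A.card : ℝ) * (2 / η * M.toFun t) = (A.card * M.toFun t) * (2 / η) := by ring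
    rw [this]
    have h6 := mul_le_mul_of_nonneg_right hN2 (show 0 ≤ 2 / η by positivity)
    refine le_trans (le_of_eq ?_) h6
    field_simp
  nlinarith

theorem exists_disjoint_card_eq (s : Finset ℕ) (N : ℕ) :
    ∃ A : Finset ℕ, Disjoint A s ∧ A.card = N := by
  obtain ⟨t, hst, ht⟩ := Infinite.exists_superset_card_eq s (N + s.card) (by omega)
  exact ⟨t \ s, Finset.sdiff_disjoint, by rw [Finset.card_sdiff_of_subset hst, ht]; omega⟩

theorem modular_add_le_one_of_disjoint {x y : hSpace M}
    (h : ∀ n, hCoord M x n = 0 ∨ hCoord M y n = 0) {η : ℝ} (hη : 0 ≤ η) (hη1 : η ≤ 1)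
    (hx : M.modular (hCoord M x) ≤ ENNReal.ofReal (1 - η))
    (hy : M.modular (hCoord M y) ≤ ENNReal.ofReal η) : ‖x + y‖ ≤ 1 := by
  rw [hNorm_le_one_iff, map_add, M.modular_add_of_disjoint h]
  refine (add_le_add hx hy).trans ?_
  rw [← ENNReal.ofReal_add (by linarith) hη]
  simp

/-! ### The diameter, monotonicity and indicator properties. -/

theorem localDiameterTwoProperty_hSpace (hΔ : FailsDeltaTwoAtZero M)
    (hM : ∀ a t : ℝ, 0 ≤ a → a ≤ 1 → 0 ≤ t → M.toFun (a * t) ≤ a ^ 2 * M.toFun t)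
    (hunit : ∀ n, ‖hUnitVec M n‖ = 1) : LocalDiameterTwoProperty (hSpace M) := by
  intro f ε hf hε
  set S := {x : hSpace M | ‖x‖ ≤ 1 ∧ 1 - ε < f x}
  have hbdd : Bornology.IsBounded S :=
    (Metric.isBounded_closedBall (x := (0 : hSpace M)) (r := 1)).subset fun x hx => by
      simpa using hx.1
  refine le_antisymm (Metric.diam_le_of_forall_dist_le zero_le_two fun x hx y hy => ?_) ?_
  · rw [dist_eq_norm]
    exact (norm_sub_le _ _).trans (by linarith [hx.1, hy.1])
  have key : ∀ c : ℝ, 1 < c → 2 * c⁻¹ ≤ Metric.diam S := by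
    intro c hc
    obtain ⟨x, hx, hfx⟩ := exists_norm_lt_one_lt_apply f (c := 1 - ε) (by linarith)
    set η : ℝ := 1 - (M.modular (hCoord M x)).toReal
    have hmx := modular_hCoord_lt_one hx
    have hη0 : 0 < η := by
      have := (ENNReal.toReal_lt_toReal hmx.ne_top ENNReal.one_ne_top).2 hmx
      rw [ENNReal.toReal_one] at this
      exact sub_pos.2 this
    have hη1 : η ≤ 1 := sub_le_self _ ENNReal.toReal_nonneg
    obtain ⟨t, N, ht, hflat⟩ := hΔ.exists_flat hc hη0
    set κ : ℝ := (f x - (1 - ε)) / 2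
    have hκ : 0 < κ := by simp only [κ]; linarith
    have hev1 : ∀ᶠ s in Filter.atTop, 1 - ε + κ < f (hProj M s x) :=
      ((f.continuous.tendsto _).comp (tendsto_hProj x)).eventually_const_lt
        (by simp only [κ]; linarith)
    -- `N` and `t` are fixed before `s`, and `‖y‖ ≤ N * t` wherever the flat vector `y` is placed,
    -- so `f` is below `κ` on it off `s`. Using `N + 1` keeps the denominator positive.
    have hev2 : ∀ᶠ s in Filter.atTop, ‖f.comp (hProj M s) - f‖ < κ / ((N + 1) * t) :=
      (tendsto_iff_norm_sub_tendsto_zero.1 (tendsto_comp_hProj hM f)).eventually_lt_const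
        (by positivity)
    obtain ⟨s, hs1, hs2⟩ := (hev1.and hev2).exists
    obtain ⟨A, hAs, hA⟩ := exists_disjoint_card_eq s N
    set y := ∑ n ∈ A, t • hUnitVec M n
    obtain ⟨hy1, hy2⟩ := hflat A hA
    have hycoord : hCoord M y = fun n => if n ∈ A then t else 0 := hCoord_sum A fun _ => t
    have hdisj : ∀ n, hCoord M (hProj M s x) n = 0 ∨ hCoord M y n = 0 := by
      intro n
      rw [hCoord_hProj, hycoord]
      by_cases hn : n ∈ s
      · right
        simp [Finset.disjoint_right.1 hAs hn]
      · left
        simp [hn]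
    have hfy : |f y| < κ := by
      have h1 : f y = -(f.comp (hProj M s) - f) y := by
        have : hProj M s y = 0 := hCoord_injective <| by
          rw [hCoord_hProj, map_zero, hycoord]
          funext n
          by_cases hn : n ∈ s
          · simp [Finset.disjoint_right.1 hAs hn]
          · simp [hn]
        simp [this]
      have h2 : ‖y‖ ≤ N * t := by
        refine (norm_sum_le _ _).trans (le_of_eq ?_)
        simp [norm_smul, hunit, hA, abs_of_pos ht]
      rw [h1, abs_neg]
      refine ((f.comp (hProj M s) - f).le_opNorm y).trans_lt ?_
      have hden : 0 < (N + 1) * t := by positivity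
      calc ‖f.comp (hProj M s) - f‖ * ‖y‖ ≤ ‖f.comp (hProj M s) - f‖ * ((N + 1) * t) :=
            mul_le_mul_of_nonneg_left (h2.trans (by nlinarith)) (norm_nonneg _)
        _ < κ / ((N + 1) * t) * ((N + 1) * t) := mul_lt_mul_of_pos_right hs2 hden
        _ = κ := div_mul_cancel₀ _ hden.ne'
    have hmPx : M.modular (hCoord M (hProj M s x)) ≤ ENNReal.ofReal (1 - η) := by
      rw [show 1 - η = (M.modular (hCoord M x)).toReal by simp [η], ENNReal.ofReal_toReal hmx.ne_top]
      refine M.modular_mono fun n => ?_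
      rw [hCoord_hProj]
      by_cases hn : n ∈ s <;> simp [hn]
    have hplus : hProj M s x + y ∈ S := by
      refine ⟨modular_add_le_one_of_disjoint hdisj hη0.le hη1 hmPx hy1, ?_⟩
      rw [map_add]
      linarith [(abs_lt.1 hfy).1]
    have hminus : hProj M s x + -y ∈ S := by
      refine ⟨modular_add_le_one_of_disjoint (fun n => ?_) hη0.le hη1 hmPx ?_, ?_⟩
      · simpa using hdisj n
      · refine (M.modular_mono fun n => le_of_eq ?_).trans hy1
        rw [map_neg, Pi.neg_apply, abs_neg]
      · rw [map_add, map_neg]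
        linarith [(abs_lt.1 hfy).2]
    have hd := Metric.dist_le_diam_of_mem hbdd hplus hminus
    rw [dist_eq_norm, show hProj M s x + y - (hProj M s x + -y) = (2 : ℝ) • y by module,
      norm_smul, Real.norm_of_nonneg zero_le_two] at hd
    linarith
  have hlim : Filter.Tendsto (fun c : ℝ => 2 * c⁻¹) (nhdsWithin 1 (Set.Ioi 1))
      (nhds (2 * 1⁻¹)) :=
    ((tendsto_inv₀ one_ne_zero).const_mul _).mono_left nhdsWithin_le_nhds
  have h := le_of_tendsto hlim (b := Metric.diam S) <| by
    filter_upwards [self_mem_nhdsWithin] with c hc using key c hc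
  simpa using h

/-- Take `a < 1` near 1 and fill the spare modular `1 - M(a)` of `a e_n` with a flat vector off `n`:
deleting coordinate `n` still leaves norm at least `1/c`. -/
theorem not_isUniformlyStrictlyMonotoneAt (hΔ : FailsDeltaTwoAtZero M)
    (hlt : ∀ t, 0 < t → t < 1 → M.toFun t < 1) (n : ℕ) :
    ¬ IsUniformlyStrictlyMonotoneAt (hCoord M) (hUnitVec M) n := by
  rintro ⟨ε, hε, hlt1⟩
  refine hlt1.not_ge ?_
  have key : ∀ c : ℝ, 1 < c →
      ENNReal.ofReal c⁻¹ ≤ strictMonotonicityModulus (hCoord M) (hUnitVec M) n ε := by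
    intro c hc
    -- The minimum with 1 keeps `a` positive when `ε` is large.
    set a : ℝ := 1 - min ε 1 / 2
    have hm0 : 0 < min ε 1 := lt_min hε one_pos
    have hm1 : min ε 1 ≤ 1 := min_le_right _ _
    have ha0 : 0 < a := by simp only [a]; linarith
    have ha1 : a < 1 := by simp only [a]; linarith
    have haε : 1 - ε < a := by
      have := min_le_left ε 1
      simp only [a]
      linarith
    have hMa := hlt a ha0 ha1
    have hMa0 := M.nonneg ha0.le
    obtain ⟨t, N, ht, hflat⟩ := hΔ.exists_flat hc (sub_pos.2 hMa)
    obtain ⟨A, hAn, hA⟩ := exists_disjoint_card_eq {n} N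
    rw [Finset.disjoint_singleton_right] at hAn
    set y := ∑ m ∈ A, t • hUnitVec M m
    obtain ⟨hy1, hy2⟩ := hflat A hA
    have hycoord : hCoord M y = fun m => if m ∈ A then t else 0 := hCoord_sum A fun _ => t
    set x := a • hUnitVec M n + y
    have hxn : hCoord M x n = a := by
      simp [x, hycoord, hAn, hCoord_hUnitVec]
    have hx1 : ‖x‖ ≤ 1 := by
      refine modular_add_le_one_of_disjoint (fun m => ?_) (sub_pos.2 hMa).le (by linarith) ?_ hy1
      · rw [hycoord, map_smul, hCoord_hUnitVec]
        by_cases hm : m = n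
        · right
          simp [hm, hAn]
        · left
          simp [hm]
      · rw [map_smul, hCoord_hUnitVec, sub_sub_cancel]
        have h2 := M.modular_indicator_const {n} a
        rw [abs_of_pos ha0, Finset.card_singleton, Nat.cast_one, one_mul] at h2
        rw [← h2]
        refine le_of_eq (congrArg _ ?_)
        funext m
        simp [Pi.single_apply]
    have hx0 : 0 < ‖x‖ := norm_pos_iff.2 fun h0 => by
      rw [h0] at hxn
      simp at hxn
      linarith
    -- Since `‖x‖ ≤ 1`, normalising can only enlarge the `n`-th coordinate and the remainder.
    refine le_trans ?_ (le_iSup₂_of_le (‖x‖⁻¹ • x) ?_ (le_iSup_of_le ?_ le_rfl))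
    · have h1 : ‖x‖⁻¹ • x - hCoord M (‖x‖⁻¹ • x) n • hUnitVec M n = ‖x‖⁻¹ • y := by
        rw [map_smul, Pi.smul_apply, hxn, smul_assoc, ← smul_sub]
        simp [x]
      rw [h1, ← ofReal_norm]
      refine ENNReal.ofReal_le_ofReal ?_
      rw [norm_smul, norm_inv, norm_norm]
      exact hy2.trans (le_mul_of_one_le_left (norm_nonneg _) ((one_le_inv₀ hx0).2 hx1))
    · rw [norm_smul, norm_inv, norm_norm, inv_mul_cancel₀ hx0.ne']
    · rw [map_smul, Pi.smul_apply, hxn, smul_eq_mul]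
      exact haε.trans_le (le_mul_of_one_le_left ha0.le ((one_le_inv₀ hx0).2 hx1))
  have hlim : Filter.Tendsto (fun c : ℝ => ENNReal.ofReal c⁻¹) (nhdsWithin 1 (Set.Ioi 1))
      (nhds (ENNReal.ofReal 1⁻¹)) :=
    (ENNReal.tendsto_ofReal (tendsto_inv₀ one_ne_zero)).mono_left nhdsWithin_le_nhds
  have h := le_of_tendsto hlim (b := strictMonotonicityModulus (hCoord M) (hUnitVec M) n ε) <| by
    filter_upwards [self_mem_nhdsWithin] with c hc using key c hc
  simpa using h

/-- At any scale the modular of `1_A` is `|A|` times a positive constant, hence unbounded. -/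
theorem finiteIndicatorSup_hUnitVec (hpos : ∀ t, 0 < t → 0 < M.toFun t) :
    finiteIndicatorSup (hUnitVec M) = ⊤ := by
  refine ENNReal.eq_top_of_forall_nnreal_le fun r => ?_
  have hr : (0 : ℝ) < r + 1 := by positivity
  obtain ⟨N, hN⟩ := exists_nat_gt (1 / M.toFun ((r : ℝ) + 1)⁻¹)
  rw [div_lt_iff₀ (hpos _ (inv_pos.2 hr))] at hN
  refine le_iSup_of_le (Finset.range N) ?_
  rw [← ofReal_norm, ← ENNReal.ofReal_coe_nnreal]
  refine ENNReal.ofReal_le_ofReal ?_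
  by_contra! hlt
  have h := (hNorm_le_iff _ hr).1 (hlt.le.trans (by linarith))
  have h1 := hCoord_sum (M := M) (Finset.range N) fun _ => 1
  simp only [one_smul] at h1
  have h2 : ((r : ℝ) + 1)⁻¹ • (fun n => if n ∈ Finset.range N then (1 : ℝ) else 0) =
      fun n => if n ∈ Finset.range N then ((r : ℝ) + 1)⁻¹ else 0 := by
    funext n
    simp
  rw [h1, h2, M.modular_indicator_const, Finset.card_range, ENNReal.ofReal_le_one,
    abs_of_pos (inv_pos.2 hr)] at h
  linarith

end OrliczSpace

/-! ### Growth and strict convexity of the explicit function. -/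

theorem expOrliczFun_of_lt_half {t : ℝ} (ht0 : 0 < t) (ht : t < 1 / 2) :
    expOrliczFun t = 1 / 4 * Real.exp 1 ^ 2 * Real.exp (-1 / t) := by
  rw [expOrliczFun, if_neg ht0.not_ge, if_pos ht]

theorem expOrliczFun_pos {t : ℝ} (ht : 0 < t) : 0 < expOrliczFun t := by
  rw [expOrliczFun, if_neg ht.not_ge]
  split_ifs <;> positivity

/-- Says that `e^{-1/t}/t²`, proportional to both `M'(t)` and `M(t)/t²` near zero, strictly
increases up to `1/2`. The threshold is the sign of `(t - s)(1/2 - t)`; strictness comes from `1 + u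
< e^u`. -/
theorem sq_div_lt_exp_inv_sub_inv {s t : ℝ} (hs : 0 < s) (hst : s < t) (ht : t ≤ 1 / 2) :
    (t / s) ^ 2 < Real.exp (1 / s - 1 / t) := by
  have ht0 : 0 < t := hs.trans hst
  have h1 : t / s < Real.exp ((1 / s - 1 / t) / 2) := by
    have h2 : t / s ≤ (1 / s - 1 / t) / 2 + 1 := by
      have h3 : (1 / s - 1 / t) / 2 + 1 - t / s = (t - s) * (1 / 2 - t) / (s * t) := by
        field_simp
        ring
      have h4 : 0 ≤ (t - s) * (1 / 2 - t) / (s * t) :=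
        div_nonneg (mul_nonneg (by linarith) (by linarith)) (by positivity)
      linarith
    have h5 := one_div_lt_one_div_of_lt hs hst
    exact h2.trans_lt (Real.add_one_lt_exp (by linarith))
  refine (pow_lt_pow_left₀ h1 (by positivity) two_ne_zero).trans_eq ?_
  rw [← Real.exp_nat_mul]
  congr 1
  push_cast
  ring

theorem expOrliczConst_mul_exp_neg_two :
    1 / 4 * Real.exp 1 ^ 2 * Real.exp (-1 / (1 / 2)) = (1 / 2 : ℝ) ^ 2 := by
  rw [← Real.exp_nat_mul, mul_assoc, ← Real.exp_add]
  norm_num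

/-- The quadratic lower growth of `expOrliczFun`: `M(t) / t²` is non-decreasing. -/
theorem expOrliczFun_mul_le {a t : ℝ} (ha0 : 0 ≤ a) (ha1 : a ≤ 1) (ht : 0 ≤ t) :
    expOrliczFun (a * t) ≤ a ^ 2 * expOrliczFun t := by
  have hexp : ∀ s t : ℝ, 0 < s → s ≤ t → t ≤ 1 / 2 →
      1 / 4 * Real.exp 1 ^ 2 * Real.exp (-1 / s) ≤
        (s / t) ^ 2 * (1 / 4 * Real.exp 1 ^ 2 * Real.exp (-1 / t)) := by
    intro s t hs hst ht
    have ht0 : 0 < t := hs.trans_le hst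
    have h5 : (t / s) ^ 2 ≤ Real.exp (1 / s - 1 / t) := by
      rcases hst.eq_or_lt with rfl | hst
      · simp [hs.ne']
      · exact (sq_div_lt_exp_inv_sub_inv hs hst ht).le
    have h6 : Real.exp (-1 / t) = Real.exp (-1 / s) * Real.exp (1 / s - 1 / t) := by
      rw [← Real.exp_add]
      congr 1
      ring
    have h7 : 1 ≤ (s / t) ^ 2 * Real.exp (1 / s - 1 / t) := by
      refine le_trans (le_of_eq ?_) (mul_le_mul_of_nonneg_left h5 (sq_nonneg (s / t)))
      field_simp
    rw [h6]
    have h8 : 0 < 1 / 4 * Real.exp 1 ^ 2 * Real.exp (-1 / s) := by positivity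
    nlinarith
  rcases ha0.eq_or_lt with rfl | ha
  · simp [expOrliczFun]
  rcases ht.eq_or_lt with rfl | ht
  · simp [expOrliczFun]
  have hat : a * t ≤ t := mul_le_of_le_one_left ht.le ha1
  have hat0 : 0 < a * t := mul_pos ha ht
  have haq : a * t / t = a := mul_div_cancel_right₀ _ ht.ne'
  rcases lt_or_ge t (1 / 2) with h | h
  · rw [expOrliczFun_of_lt_half hat0 (hat.trans_lt h), expOrliczFun_of_lt_half ht h]
    have := hexp _ _ hat0 hat h.le
    rwa [haq] at this
  · rw [expOrliczFun_eq_sq h, ← mul_pow]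
    rcases lt_or_ge (a * t) (1 / 2) with h' | h'
    · rw [expOrliczFun_of_lt_half hat0 h']
      -- Across the junction, compare with the value `M(1/2) = 1/4`, where both branches agree.
      refine (hexp _ _ hat0 h'.le le_rfl).trans_eq ?_
      rw [expOrliczConst_mul_exp_neg_two]
      ring
    · rw [expOrliczFun_eq_sq h']

/-- For small `t`, `M(ct)/M(t) = exp((1 - 1/c)/t)`, which tends to infinity as `t ↓ 0`. -/
theorem expOrlicz_failsDeltaTwoAtZero : OrliczSpace.FailsDeltaTwoAtZero expOrlicz := by
  intro c K η hc hK hη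
  change ∃ t : ℝ, 0 < t ∧ 0 < expOrliczFun t ∧ expOrliczFun t ≤ η ∧
    K * expOrliczFun t < expOrliczFun (c * t)
  have hc0 : 0 < c := by linarith
  have hlim : Filter.Tendsto (fun t : ℝ => Real.exp ((1 - c⁻¹) * t⁻¹)) (nhdsWithin 0 (Set.Ioi 0))
      Filter.atTop :=
    Real.tendsto_exp_atTop.comp (tendsto_inv_nhdsGT_zero.const_mul_atTop
      (sub_pos.2 (inv_lt_one_of_one_lt₀ hc)))
  have hcont : Filter.Tendsto expOrliczFun (nhdsWithin 0 (Set.Ioi 0)) (nhds 0) := by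
    have := expOrliczFun_continuous.tendsto 0
    rw [show expOrliczFun 0 = 0 by simp [expOrliczFun]] at this
    exact this.mono_left nhdsWithin_le_nhds
  obtain ⟨t, h1, h2, h3, h4⟩ := ((hlim.eventually_gt_atTop K).and
    ((hcont.eventually_le_const hη).and ((Ioo_mem_nhdsGT
      (show (0 : ℝ) < 1 / (2 * c) by positivity))))).exists
  have hct : c * t < 1 / 2 := by
    rw [lt_div_iff₀ (by positivity)] at h4
    linarith
  refine ⟨t, h3, expOrliczFun_pos h3, h2, ?_⟩
  have ht : t < 1 / 2 := by nlinarith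
  rw [expOrliczFun_of_lt_half h3 ht, expOrliczFun_of_lt_half (by positivity) hct]
  have h5 : Real.exp (-1 / (c * t)) = Real.exp ((1 - c⁻¹) * t⁻¹) * Real.exp (-1 / t) := by
    rw [← Real.exp_add]
    congr 1
    field_simp
    ring
  rw [h5]
  have h6 : 0 < 1 / 4 * Real.exp 1 ^ 2 * Real.exp (-1 / t) := by positivity
  nlinarith

theorem expOrliczDeriv_strictMonoOn : StrictMonoOn expOrliczDeriv (Set.Ioi 0) := by
  have hL : ∀ s t : ℝ, 0 < s → s < t → t ≤ 1 / 2 →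
      1 / 4 * Real.exp 1 ^ 2 * Real.exp (-1 / s) / s ^ 2 <
        1 / 4 * Real.exp 1 ^ 2 * Real.exp (-1 / t) / t ^ 2 := by
    intro s t hs hst ht
    have ht0 : 0 < t := hs.trans hst
    have h := sq_div_lt_exp_inv_sub_inv hs hst ht
    rw [div_pow, div_lt_iff₀ (by positivity)] at h
    rw [div_lt_div_iff₀ (by positivity) (by positivity)]
    have h6 : Real.exp (-1 / t) = Real.exp (-1 / s) * Real.exp (1 / s - 1 / t) := by
      rw [← Real.exp_add]
      congr 1
      ring
    rw [h6, ← mul_assoc, mul_assoc _ (Real.exp (1 / s - 1 / t))]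
    exact mul_lt_mul_of_pos_left h (by positivity)
  intro s hs t ht hst
  rw [Set.mem_Ioi] at hs ht
  unfold expOrliczDeriv
  split_ifs with h1 h2 h2
  · exact hL s t hs hst h2.le
  · have h3 := hL s (1 / 2) hs h1 le_rfl
    rw [expOrliczConst_mul_exp_neg_two, div_self (by positivity)] at h3
    linarith
  · linarith
  · linarith

theorem expOrliczFun_strictConvexOn : StrictConvexOn ℝ (Set.Ici 0) expOrliczFun := by
  have hd : ∀ t ∈ interior (Set.Ici (0 : ℝ)), HasDerivAt expOrliczFun (expOrliczDeriv t) t := by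
    intro t ht
    rw [interior_Ici] at ht
    exact expOrliczFun_hasDerivAt ht
  refine StrictMonoOn.strictConvexOn_of_deriv (convex_Ici 0)
    expOrliczFun_continuous.continuousOn fun s hs t ht hst => ?_
  rw [(hd s hs).deriv, (hd t ht).deriv]
  rw [interior_Ici] at hs ht
  exact expOrliczDeriv_strictMonoOn hs ht hst

/-- Quadratic growth with ratio `s/t < 1` gives `M(s) ≤ (s/t)² M(t) < M(t)`. -/
theorem expOrliczFun_strictMonoOn : StrictMonoOn expOrliczFun (Set.Ici 0) := by
  intro s hs t ht hst
  have ht0 : 0 < t := lt_of_le_of_lt hs hst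
  have h := expOrliczFun_mul_le (div_nonneg hs ht) ((div_le_one ht0).2 hst.le) ht
  rw [div_mul_cancel₀ _ ht0.ne'] at h
  refine h.trans_lt (mul_lt_of_lt_one_left (expOrliczFun_pos ht0) ?_)
  exact pow_lt_one₀ (div_nonneg hs ht) ((div_lt_one ht0).2 hst) two_ne_zero

/-- Coordinates of two vectors may differ only in sign. Then `|ax + by| < |x|` and strict
monotonicity decides; otherwise strict convexity on the half-line does. -/
theorem expOrliczFun_abs_strictConvexOn :
    StrictConvexOn ℝ Set.univ fun t : ℝ => expOrliczFun |t| := by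
  refine ⟨convex_univ, fun x _ y _ hxy a b ha hb hab => ?_⟩
  have hmem : ∀ u : ℝ, |u| ∈ Set.Ici (0 : ℝ) := fun u => abs_nonneg u
  have habs : |a * x + b * y| ≤ a * |x| + b * |y| := by
    refine (abs_add_le _ _).trans_eq ?_
    rw [abs_mul, abs_mul, abs_of_pos ha, abs_of_pos hb]
  have hcomb : a * |x| + b * |y| ∈ Set.Ici (0 : ℝ) := (abs_nonneg _).trans habs
  simp only [smul_eq_mul]
  by_cases h : |x| = |y|
  · have hx0 : 0 < |x| := abs_pos.2 fun h0 => hxy (by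
      rw [h0, abs_zero] at h
      rw [h0, abs_eq_zero.1 h.symm])
    have hyx : y = -x := by
      rcases abs_eq_abs.1 h with h | h
      · exact absurd h hxy
      · rw [h, neg_neg]
    have hlt : |a * x + b * y| < |x| := by
      have h1 : a * x + b * y = (a - b) * x := by rw [hyx]; ring
      rw [h1, abs_mul]
      exact mul_lt_of_lt_one_left hx0 (abs_lt.2 ⟨by linarith, by linarith⟩)
    rw [← h, ← add_mul, hab, one_mul]
    exact expOrliczFun_strictMonoOn (hmem _) (hmem _) hlt
  · exact (expOrliczFun_strictMonoOn.monotoneOn (hmem _) hcomb habs).trans_lt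
      (expOrliczFun_strictConvexOn.2 (hmem x) (hmem y) h ha hb hab)

theorem mainTheorem8 :
    CompleteSpace (OrliczSpace expOrlicz) ∧
    IsSolidBanachLattice (OrliczSpace.hCoord expOrlicz) ∧
    IsOneSymmetricBasis (OrliczSpace.hUnitVec expOrlicz) ∧
    StrictConvexSpace ℝ (OrliczSpace.hSpace expOrlicz) ∧
    IsMEmbedded (OrliczSpace.hSpace expOrlicz) ∧
    LocalDiameterTwoProperty (OrliczSpace.hSpace expOrlicz) ∧
    (∀ n : ℕ, ¬ IsUniformlyStrictlyMonotoneAt (OrliczSpace.hCoord expOrlicz)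
      (OrliczSpace.hUnitVec expOrlicz) n) ∧
    finiteIndicatorSup (OrliczSpace.hUnitVec expOrlicz) = ⊤ := by
  have h1 : expOrlicz.toFun 1 = 1 := by
    change expOrliczFun 1 = 1
    rw [expOrliczFun_eq_sq (by norm_num), one_pow]
  have hgt : ∀ t, 1 < t → 1 < expOrlicz.toFun t := fun t ht => by
    rw [← h1]
    exact expOrliczFun_strictMonoOn (Set.mem_Ici.2 zero_le_one)
      (Set.mem_Ici.2 (by linarith)) ht
  have hlt : ∀ t, 0 < t → t < 1 → expOrlicz.toFun t < 1 := fun t ht0 ht => by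
    rw [← h1]
    exact expOrliczFun_strictMonoOn (Set.mem_Ici.2 ht0.le) (Set.mem_Ici.2 zero_le_one) ht
  have hsq : ∀ a t : ℝ, 0 ≤ a → a ≤ 1 → 0 ≤ t →
      expOrlicz.toFun (a * t) ≤ a ^ 2 * expOrlicz.toFun t :=
    fun _ _ ha0 ha1 ht => expOrliczFun_mul_le ha0 ha1 ht
  exact ⟨inferInstance, OrliczSpace.isSolidBanachLattice_hCoord h1 hgt,
    OrliczSpace.isOneSymmetricBasis_hUnitVec,
    OrliczSpace.strictConvexSpace_hSpace expOrliczFun_abs_strictConvexOn,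
    OrliczSpace.isMEmbedded_hSpace hsq,
    OrliczSpace.localDiameterTwoProperty_hSpace expOrlicz_failsDeltaTwoAtZero hsq
      (OrliczSpace.norm_hUnitVec h1 hgt),
    OrliczSpace.not_isUniformlyStrictlyMonotoneAt expOrlicz_failsDeltaTwoAtZero hlt,
    OrliczSpace.finiteIndicatorSup_hUnitVec fun _ => expOrliczFun_pos⟩
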